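/- Let $n\in\mathbb{N}$, let $\mathbb{B}=\{x\in\mathbb{R}^n : |x|<1\}$ be the open unit ball and $b\mathbb{B}$ the unit sphere. A \emph{majorant} is a continuous non-decreasing function $B:[0,\infty)\to[0,\infty)$ with $B(0)=0$ such that $B(t)/t$ is non-increasing on $(0,\infty)$; it is \emph{regular} if there is $C>0$ such that for all sufficiently small $\delta>0$ \[\int_0^\delta \frac{B(t)}{t}\,dt+\delta\int_\delta^\infty\frac{B(t)}{t^2}\,dt\le C\,B(\delta)\] (in particular both integrals are finite). A \emph{family of curves transversal to $b\mathbb{B}$} is a $C^2$ map $\Gamma:b\mathbb{B}\times(-a,a)\to\mathbb{R}^n$, for some $a>0$, such that, with $\gamma_p(t)=\Gamma(p,t)$, we have $\gamma_p(0)=p$ for all $p\in b\mathbb{B}$, and there is $c>0$ with $\gamma_p'(t)\cdot p\le -c$ for all $p\in b\mathbb{B}$ and $t\in(-a,a)$ (note that $p$ is the outward unit normal to $b\mathbb{B}$ at $p$). Such curves satisfy $\gamma_p(t)\in\mathbb{B}$ for all $p\in b\mathbb{B}$ and all sufficiently small $t>0$, uniformly in $p$. \textbf{Theorem.} Let $B$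 be a regular majorant, let $\Gamma$ be a family of curves transversal to $b\mathbb{B}$, and let $u:\mathbb{B}\to\mathbb{R}$ be harmonic. Suppose that $u$ is Lipschitz-$B$ along $\Gamma$, that is, there are $C>0$ and $\varepsilon>0$ such that \[|u(\gamma_p(s))-u(\gamma_p(t))|\le C\,B(|s-t|)\] for all $p\in b\mathbb{B}$ and all $s,t\in(0,\varepsilon)$ with $\gamma_p(s),\gamma_p(t)\in\mathbb{B}$. Then $u\in\Lambda_B(\mathbb{B})$, that is, there is $C_u>0$ such that \[|u(x)-u(y)|\le C_u\,B(|x-y|)\quad\text{for all } x,y\in\mathbb{B}.\] -/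

import Mathlib

open Set Metric MeasureTheory Filter Topology

namespace TransLip

/-- A majorant: a continuous function `B : [0, ∞) → [0, ∞)` with `B 0 = 0`, non-decreasing, and
with `B t / t` non-increasing (on `t > 0`). Only the values of `B` on `[0, ∞)` matter. -/
structure IsMajorant (B : ℝ → ℝ) : Prop where
  continuousOn : ContinuousOn B (Ici 0)
  nonneg : ∀ t, 0 ≤ t → 0 ≤ B t
  map_zero : B 0 = 0
  monotoneOn : MonotoneOn B (Ici 0)
  antitoneOn_div : AntitoneOn (fun t => B t / t) (Ioi 0)

/-- A regular majorant: for some `C > 0` and all sufficiently small `δ > 0`,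
`∫_0^δ B(t)/t dt + δ ∫_δ^∞ B(t)/t² dt ≤ C B(δ)`; in particular both integrals are finite. -/
structure IsRegularMajorant (B : ℝ → ℝ) : Prop extends IsMajorant B where
  regular : ∃ C : ℝ, 0 < C ∧ ∃ δ₀ : ℝ, 0 < δ₀ ∧ ∀ δ : ℝ, 0 < δ → δ < δ₀ →
    IntegrableOn (fun t => B t / t) (Ioc 0 δ) ∧
    IntegrableOn (fun t => B t / t ^ 2) (Ioi δ) ∧
    (∫ t in Ioc 0 δ, B t / t) + δ * (∫ t in Ioi δ, B t / t ^ 2) ≤ C * B δ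

/-- The space `Λ_B(Ω)` of Lipschitz-`B` functions on `Ω`. A function on `Ω` is represented by a
function on the whole space; only its values on `Ω` matter. -/
def LipschitzSpace {n : ℕ} (B : ℝ → ℝ) (Ω : Set (EuclideanSpace ℝ (Fin n))) :
    Set (EuclideanSpace ℝ (Fin n) → ℝ) :=
  {f | ∃ C : ℝ, 0 < C ∧ ∀ x ∈ Ω, ∀ y ∈ Ω, |f x - f y| ≤ C * B ‖x - y‖}

/-- `Γ` (restricted to `S × (-a, a)`, where `S` is the unit sphere) is a family of curves
transversal to the boundary `S` of the unit ball. Here `γ_p = Γ p`, and the outward unit normal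
to `S` at `p` is `p` itself. Since `S × (-a, a)` is a smooth submanifold and a smooth retract of an
open set, `ContDiffOn ℝ 2` on it says exactly that `Γ` is a `C²` map on this manifold
(equivalently, that it has a `C²` extension to an open neighbourhood). -/
structure IsTransversalFamily {n : ℕ} (a : ℝ)
    (Γ : EuclideanSpace ℝ (Fin n) → ℝ → EuclideanSpace ℝ (Fin n)) : Prop where
  pos : 0 < a
  contDiffOn : ContDiffOn ℝ 2
    (fun q : EuclideanSpace ℝ (Fin n) × ℝ => Γ q.1 q.2) (sphere 0 1 ×ˢ Ioo (-a) a)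
  initial : ∀ p ∈ sphere (0 : EuclideanSpace ℝ (Fin n)) 1, Γ p 0 = p
  transversal : ∃ c : ℝ, 0 < c ∧ ∀ p ∈ sphere (0 : EuclideanSpace ℝ (Fin n)) 1,
    ∀ t ∈ Ioo (-a) a, inner ℝ (deriv (Γ p) t) p ≤ -c

/-- `f`, a function on the unit ball, is transversally Lipschitz-`B` along `Γ`: there are `C > 0`
and `ε > 0` with `|f(γ_p(s)) - f(γ_p(t))| ≤ C B(|s - t|)` for all `p` in the unit sphere and
`0 < s, t < ε`. For small `ε`, the points `γ_p(s)` and `γ_p(t)` lie in the unit ball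
automatically; the membership hypotheses only keep `f` from being evaluated outside it. -/
def IsTransversallyLipschitz {n : ℕ} (B : ℝ → ℝ)
    (Γ : EuclideanSpace ℝ (Fin n) → ℝ → EuclideanSpace ℝ (Fin n))
    (f : EuclideanSpace ℝ (Fin n) → ℝ) : Prop :=
  ∃ C : ℝ, 0 < C ∧ ∃ ε : ℝ, 0 < ε ∧ ∀ p ∈ sphere (0 : EuclideanSpace ℝ (Fin n)) 1,
    ∀ s ∈ Ioo 0 ε, ∀ t ∈ Ioo 0 ε, Γ p s ∈ ball 0 1 → Γ p t ∈ ball 0 1 →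
      |f (Γ p s) - f (Γ p t)| ≤ C * B |s - t|

end TransLip

/-!
The classical route to `u ∈ Λ_B` is the gradient estimate `|∇u(x)| ≤ C B(δ)/δ` with `δ = 1 - |x|`:
by the Dini half of regularity it can be integrated up to the sphere
(`mem_lipschitzSpace_of_norm_fderiv_le`). The hypothesis only controls `u` along the curves, so the
gradient has to be recovered from one direction.

Let `x` be near the sphere, `p = x / |x|` and `V = γ_p'(0)`. The curves fill a collar of the ball,
by the inverse function theorem for `y ↦ Γ(y / |y|, 1 - |y|)` and compactness
(`exists_collarBound`), so every point `z` with `|z - x| ≤ δ / 2` lies on some curve, and following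
that curve for time `δ` leads to `z + δ V` up to an error `O(δ²)`
(`exists_inwardStepBound`). Since `u` is bounded, `|∇u| = O(1/δ)` near these points, and therefore
`w(z) = u(z + δ V) - u(z)` is `O(B(δ) + δ) = O(B(δ))`, unless `B` vanishes identically. The function
`w` is harmonic, so the interior gradient estimate gives
`|∇u(x)| ≤ |∇u(x + δ V)| + O(B(δ)/δ)`. By transversality `x + δ V` is at distance at least
`(1 + 2κ) δ` from the sphere. Iterating until a fixed compact ball is reached produces a sum
comparable with `∫_δ^∞ B(t)/t² dt`, which the other half of regularity bounds by `C B(δ)/δ`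
(`IsRegularMajorant.exists_norm_fderiv_le`). If `B` vanishes identically, then `u` is constant
along the curves, attains its maximum inside the ball, and is constant by the strong maximum
principle.

The facts about harmonic functions in `n` variables that are needed here all follow from a mean
value property with the weight `(1 - |y|²)₊` (`HarmonicOnNhd.integral_radialKernel_mul`): the
gradient estimate comes from translating the weight.
-/

/-! ### The mean value property with a radial kernel -/

section MeanValue

variable {E : Type*} [NormedAddCommGroup E]

/-- The radial weight `y ↦ (1 - |y|²)₊`, supported in the closed unit ball. Averages against it
replace averages over balls in the mean value property: its square `ψ` is `C¹`, and the field
`(1 - |y|²)₊ y` is the gradient of `-ψ / 4`. -/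
def radialKernel (y : E) : ℝ := max (1 - ‖y‖ ^ 2) 0

lemma radialKernel_nonneg (y : E) : 0 ≤ radialKernel y := le_max_right _ _

lemma continuous_radialKernel : Continuous (radialKernel : E → ℝ) := by
  unfold radialKernel; fun_prop

lemma radialKernel_of_one_le {y : E} (hy : 1 ≤ ‖y‖) : radialKernel y = 0 := by
  unfold radialKernel
  exact max_eq_right (by nlinarith)

lemma radialKernel_pos {y : E} (hy : ‖y‖ < 1) : 0 < radialKernel y := by
  unfold radialKernel
  exact lt_max_of_lt_left (by nlinarith [norm_nonneg y])

variable [InnerProductSpace ℝ E]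

lemma hasCompactSupport_radialKernel [FiniteDimensional ℝ E] :
    HasCompactSupport (radialKernel : E → ℝ) := by
  refine HasCompactSupport.intro (isCompact_closedBall (0 : E) 1) fun y hy => ?_
  rw [mem_closedBall_zero_iff, not_le] at hy
  exact radialKernel_of_one_le hy.le

lemma hasDerivAt_max_zero_sq (s : ℝ) : HasDerivAt (fun s : ℝ => max s 0 ^ 2) (2 * max s 0) s := by
  have key : ∀ t : ℝ, t ≠ 0 → HasDerivAt (fun s : ℝ => max s 0 ^ 2) (2 * max t 0) t := by
    intro t ht
    rcases lt_or_gt_of_ne ht with h | h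
    · have : (fun s : ℝ => max s 0 ^ 2) =ᶠ[𝓝 t] fun _ => 0 := by
        filter_upwards [Iio_mem_nhds h] with y hy
        rw [max_eq_right (le_of_lt hy)]; simp
      rw [max_eq_right h.le, mul_zero]
      exact (hasDerivAt_const t (0 : ℝ)).congr_of_eventuallyEq this
    · have : (fun s : ℝ => max s 0 ^ 2) =ᶠ[𝓝 t] fun s => s ^ 2 := by
        filter_upwards [Ioi_mem_nhds h] with y hy
        rw [max_eq_left (le_of_lt hy)]
      rw [max_eq_left h.le]
      simpa using (hasDerivAt_pow 2 t).congr_of_eventuallyEq this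
  rcases eq_or_ne s 0 with rfl | hs
  · exact hasDerivAt_of_hasDerivAt_of_ne key (by fun_prop) (by fun_prop)
  · exact key s hs

lemma hasFDerivAt_radialKernel_sq (y : E) :
    HasFDerivAt (fun y : E => radialKernel y ^ 2) ((-4 * radialKernel y) • innerSL ℝ y) y := by
  have h1 : HasFDerivAt (fun y : E => 1 - ‖y‖ ^ 2) (-(2 • innerSL ℝ y)) y :=
    ((hasStrictFDerivAt_norm_sq y).hasFDerivAt).const_sub 1
  have h2 := (hasDerivAt_max_zero_sq (1 - ‖y‖ ^ 2)).comp_hasFDerivAt y h1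
  refine h2.congr_fderiv ?_
  ext z
  simp [radialKernel]
  ring

variable [FiniteDimensional ℝ E]

/-- A cutoff: a harmonic function near a closed ball agrees there with a globally defined, compactly
supported `C²` function whose Laplacian vanishes on that ball. -/
lemma exists_contDiff_hasCompactSupport_eqOn_closedBall {u : E → ℝ} {x : E} {R : ℝ} (hR : 0 < R)
    (hu : InnerProductSpace.HarmonicOnNhd u (closedBall x R)) :
    ∃ v : E → ℝ, ContDiff ℝ 2 v ∧ HasCompactSupport v ∧
      ∀ z ∈ closedBall x R, v z = u z ∧ Laplacian.laplacian v z = 0 := by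
  have hopen := InnerProductSpace.isOpen_setOfPred_harmonicAt u
  obtain ⟨η, hη, hsub⟩ := (isCompact_closedBall x R).exists_cthickening_subset_open hopen
    (fun z hz => hu z hz)
  rw [cthickening_closedBall hη.le hR.le] at hsub
  let χ : ContDiffBump x := ⟨R + η / 2, R + η, by positivity, by linarith⟩
  have hχ : ContDiff ℝ 2 χ := χ.contDiff (n := 2)
  have hsupp : tsupport χ = closedBall x (R + η) := χ.tsupport_eq
  refine ⟨fun z => χ z * u z, ?_, ?_, ?_⟩
  · rw [contDiff_iff_contDiffAt]
    intro z
    by_cases hz : z ∈ closedBall x (R + η)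
    · exact hχ.contDiffAt.mul (hsub (by rwa [add_comm])).1
    · have : (fun z => χ z * u z) =ᶠ[𝓝 z] fun _ => 0 := by
        filter_upwards [isClosed_closedBall.isOpen_compl.mem_nhds hz] with w hw
        have : χ w = 0 := by
          by_contra h
          exact hw (hsupp ▸ subset_tsupport _ h)
        rw [this, zero_mul]
      exact contDiffAt_const.congr_of_eventuallyEq this
  · exact χ.hasCompactSupport.mul_right
  · intro z hz
    have heq : (fun z => χ z * u z) =ᶠ[𝓝 z] u := by
      have : ball x (R + η / 2) ∈ 𝓝 z :=
        isOpen_ball.mem_nhds (closedBall_subset_ball (by linarith) hz)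
      filter_upwards [this] with w hw
      rw [χ.one_of_mem_closedBall (ball_subset_closedBall hw), one_mul]
    refine ⟨heq.self_of_nhds, ?_⟩
    rw [(InnerProductSpace.laplacian_congr_nhds heq).self_of_nhds]
    exact (hu z hz).2.self_of_nhds

variable [MeasurableSpace E] [BorelSpace E]

lemma integrable_radialKernel_mul {g : E → ℝ} (hg : Continuous g) :
    Integrable (fun y : E => radialKernel y * g y) :=
  (continuous_radialKernel.mul hg).integrable_of_hasCompactSupport
    hasCompactSupport_radialKernel.mul_right

lemma integral_radialKernel_pos : 0 < ∫ y : E, radialKernel y := by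
  refine continuous_radialKernel.integral_pos_of_hasCompactSupport_nonneg_nonzero
    hasCompactSupport_radialKernel radialKernel_nonneg (x := 0) ?_
  exact (radialKernel_pos (by simp)).ne'

/-- The divergence theorem for the compactly supported field `y ↦ ψ(y) ∇v(x + r y)` with
`ψ = radialKernel ^ 2`. -/
lemma four_mul_integral_radialKernel_mul_fderiv {v : E → ℝ} (hv : ContDiff ℝ 2 v) (x : E) (r : ℝ) :
    4 * ∫ y : E, radialKernel y * fderiv ℝ v (x + r • y) y =
      r * ∫ y : E, radialKernel y ^ 2 * Laplacian.laplacian v (x + r • y) := by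
  set b := stdOrthonormalBasis ℝ E
  have hv1 : ContDiff ℝ 1 (fderiv ℝ v) := hv.fderiv_right (by norm_num)
  have hDv : Continuous (fderiv ℝ v) := hv1.continuous
  have hD2v : Continuous (fderiv ℝ (fderiv ℝ v)) := hv1.continuous_fderiv (by norm_num)
  have hψ : Continuous fun y : E => radialKernel y ^ 2 := continuous_radialKernel.pow 2
  have hψc : HasCompactSupport fun y : E => radialKernel y ^ 2 := by
    simp only [pow_two]
    exact hasCompactSupport_radialKernel.mul_right
  have parts : ∀ i, ∫ y : E, radialKernel y ^ 2 *
        (r * fderiv ℝ (fderiv ℝ v) (x + r • y) (b i) (b i)) =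
      ∫ y : E, 4 * (radialKernel y * (inner ℝ y (b i) * fderiv ℝ v (x + r • y) (b i))) := by
    intro i
    have hg : ∀ y : E, HasFDerivAt (fun y => fderiv ℝ v (x + r • y) (b i))
        (((ContinuousLinearMap.apply ℝ ℝ (b i)).comp
          (fderiv ℝ (fderiv ℝ v) (x + r • y))).comp (r • ContinuousLinearMap.id ℝ E)) y := by
      intro y
      have h1 : HasFDerivAt (fun y : E => x + r • y) (r • ContinuousLinearMap.id ℝ E) y :=
        ((hasFDerivAt_id y).const_smul r).const_add x
      have h2 := ((hv1.differentiable (by norm_num)) (x + r • y)).hasFDerivAt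
      exact ((ContinuousLinearMap.apply ℝ ℝ (b i)).hasFDerivAt.comp _ h2).comp y h1
    have hgv : ∀ y : E, fderiv ℝ (fun y => fderiv ℝ v (x + r • y) (b i)) y (b i) =
        r * fderiv ℝ (fderiv ℝ v) (x + r • y) (b i) (b i) := by
      intro y
      rw [(hg y).fderiv]
      simp
    have hf : ∀ y : E, fderiv ℝ (fun y : E => radialKernel y ^ 2) y (b i) =
        -4 * radialKernel y * inner ℝ y (b i) := by
      intro y
      rw [(hasFDerivAt_radialKernel_sq y).fderiv]
      simp
    have key := integral_mul_fderiv_eq_neg_fderiv_mul_of_integrable (μ := (volume : Measure E))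
      (f := fun y : E => radialKernel y ^ 2)
      (g := fun y => fderiv ℝ v (x + r • y) (b i)) (v := b i) ?_ ?_ ?_
      (fun y _ => (hasFDerivAt_radialKernel_sq y).differentiableAt)
      (fun y _ => (hg y).differentiableAt)
    · simp only [hgv, hf] at key
      rw [key, ← integral_neg]
      congr 1; ext y; ring
    · simp only [hf]
      have : Continuous fun y : E => (-4 * inner ℝ y (b i)) * fderiv ℝ v (x + r • y) (b i) := by
        fun_prop
      refine (integrable_radialKernel_mul this).congr (ae_of_all _ fun y => ?_)
      simp only; ring
    · simp only [hgv]
      refine Continuous.integrable_of_hasCompactSupport ?_ hψc.mul_right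
      fun_prop
    · refine Continuous.integrable_of_hasCompactSupport ?_ hψc.mul_right
      fun_prop
  have hL : ∀ y : E, r * (radialKernel y ^ 2 * Laplacian.laplacian v (x + r • y)) =
      ∑ i, radialKernel y ^ 2 * (r * fderiv ℝ (fderiv ℝ v) (x + r • y) (b i) (b i)) := by
    intro y
    rw [InnerProductSpace.laplacian_eq_iteratedFDeriv_orthonormalBasis v b]
    simp only [iteratedFDeriv_two_apply, Finset.mul_sum]
    refine Finset.sum_congr rfl fun i _ => ?_
    simp; ring
  have hR : ∀ y : E, 4 * (radialKernel y * fderiv ℝ v (x + r • y) y) =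
      ∑ i, 4 * (radialKernel y * (inner ℝ y (b i) * fderiv ℝ v (x + r • y) (b i))) := by
    intro y
    have hy : fderiv ℝ v (x + r • y) y = ∑ i, inner ℝ y (b i) * fderiv ℝ v (x + r • y) (b i) := by
      conv_lhs => enter [2]; rw [← b.sum_repr y]
      rw [map_sum]
      refine Finset.sum_congr rfl fun i _ => ?_
      rw [map_smul, b.repr_apply_apply, real_inner_comm, smul_eq_mul]
    rw [hy, Finset.mul_sum, Finset.mul_sum]
  rw [← integral_const_mul, ← integral_const_mul]
  simp only [hL, hR]
  rw [integral_finsetSum, integral_finsetSum]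
  · exact Finset.sum_congr rfl fun i _ => (parts i).symm
  · intro i _
    refine Continuous.integrable_of_hasCompactSupport ?_ hψc.mul_right
    fun_prop
  · intro i _
    refine (integrable_radialKernel_mul ?_).const_mul 4
    fun_prop

lemma hasDerivAt_integral_radialKernel_mul {v : E → ℝ} (hv : ContDiff ℝ 1 v)
    (hvc : HasCompactSupport v) (x : E) (r : ℝ) :
    HasDerivAt (fun r : ℝ => ∫ y : E, radialKernel y * v (x + r • y))
      (∫ y : E, radialKernel y * fderiv ℝ v (x + r • y) y) r := by
  have hDv : Continuous (fderiv ℝ v) := hv.continuous_fderiv (by norm_num)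
  have hvcont := hv.continuous
  obtain ⟨M, hM⟩ := (hvc.fderiv ℝ).exists_bound_of_continuous hDv
  refine (hasDerivAt_integral_of_dominated_loc_of_deriv_le (s := univ) univ_mem
    (F' := fun r y => radialKernel y * fderiv ℝ v (x + r • y) y)
    (bound := fun y => radialKernel y * (M * ‖y‖)) ?_ ?_ ?_ ?_ ?_ ?_).2
  · refine Eventually.of_forall fun s => ?_
    exact (integrable_radialKernel_mul (by fun_prop)).aestronglyMeasurable
  · exact integrable_radialKernel_mul (by fun_prop)
  · exact (integrable_radialKernel_mul (by fun_prop)).aestronglyMeasurable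
  · refine ae_of_all _ fun y s _ => ?_
    rw [norm_mul, Real.norm_of_nonneg (radialKernel_nonneg y)]
    gcongr
    · exact radialKernel_nonneg y
    · exact (ContinuousLinearMap.le_opNorm _ _).trans (by gcongr; exact hM _)
  · exact integrable_radialKernel_mul (by fun_prop)
  · refine ae_of_all _ fun y s _ => ?_
    have h1 : HasDerivAt (fun s : ℝ => x + s • y) y s := by
      simpa using ((hasDerivAt_id s).smul_const y).const_add x
    have h2 := ((hv.differentiable (by norm_num)) (x + s • y)).hasFDerivAt
    exact (h2.comp_hasDerivAt s h1).const_mul _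

/-- The mean value property of harmonic functions, for averages against `radialKernel`. -/
theorem InnerProductSpace.HarmonicOnNhd.integral_radialKernel_mul {u : E → ℝ} {x : E} {R : ℝ}
    (hR : 0 < R) (hu : InnerProductSpace.HarmonicOnNhd u (closedBall x R)) :
    ∫ y : E, radialKernel y * u (x + R • y) = (∫ y : E, radialKernel y) * u x := by
  obtain ⟨v, hv, hvc, hvu⟩ := exists_contDiff_hasCompactSupport_eqOn_closedBall hR hu
  have hmem : ∀ r ∈ Icc 0 R, ∀ y : E, ‖y‖ < 1 → x + r • y ∈ closedBall x R := by
    intro r hr y hy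
    rw [mem_closedBall, dist_self_add_left, norm_smul, Real.norm_of_nonneg hr.1]
    nlinarith [hr.1, hr.2, norm_nonneg y]
  have hder : ∀ r ∈ Icc 0 R, HasDerivAt (fun r : ℝ => ∫ y : E, radialKernel y * v (x + r • y))
      0 r := by
    intro r hr
    have h1 := hasDerivAt_integral_radialKernel_mul (hv.of_le (by norm_num)) hvc x r
    have h2 := four_mul_integral_radialKernel_mul_fderiv hv x r
    have h3 : ∀ y : E, radialKernel y ^ 2 * Laplacian.laplacian v (x + r • y) = 0 := by
      intro y
      rcases lt_or_ge ‖y‖ 1 with hy | hy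
      · rw [(hvu _ (hmem r hr y hy)).2, mul_zero]
      · rw [radialKernel_of_one_le hy]; simp
    simp only [h3, integral_zero, mul_zero, mul_eq_zero, OfNat.ofNat_ne_zero, false_or] at h2
    rwa [h2] at h1
  have hconst := constant_of_has_deriv_right_zero (a := 0) (b := R)
    (fun r hr => (hder r hr).continuousAt.continuousWithinAt)
    (fun r hr => (hder r (Ico_subset_Icc_self hr)).hasDerivWithinAt) R ⟨hR.le, le_rfl⟩
  simp only [zero_smul, add_zero, integral_mul_const] at hconst
  rw [(hvu x (mem_closedBall_self hR.le)).1] at hconst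
  rw [← hconst]
  congr 1; ext y
  rcases lt_or_ge ‖y‖ 1 with hy | hy
  · rw [(hvu _ (hmem R ⟨hR.le, le_rfl⟩ y hy)).1]
  · rw [radialKernel_of_one_le hy]; simp

/-- Interior Lipschitz estimate for harmonic functions: the constant depends only on the space.
The point of evaluation is moved by translating the kernel in the mean value property. -/
theorem exists_abs_sub_le_of_harmonicOnNhd (E : Type*) [NormedAddCommGroup E]
    [InnerProductSpace ℝ E] [FiniteDimensional ℝ E] [MeasurableSpace E] [BorelSpace E] :
    ∃ C : ℝ, 0 < C ∧ ∀ (w : E → ℝ) (x x' : E) (r M : ℝ), 0 < r →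
      InnerProductSpace.HarmonicOnNhd w (closedBall x (2 * r)) →
      (∀ z ∈ closedBall x (2 * r), |w z| ≤ M) → x' ∈ closedBall x r →
      |w x' - w x| ≤ C * M / r * ‖x' - x‖ := by
  have hm := integral_radialKernel_pos (E := E)
  set m := ∫ y : E, radialKernel y
  have hv0 : 0 < volume.real (closedBall (0 : E) 2) := by
    refine ENNReal.toReal_pos ?_ (measure_closedBall_lt_top).ne
    exact (measure_closedBall_pos volume (0 : E) (by norm_num)).ne'
  refine ⟨5 * volume.real (closedBall (0 : E) 2) / m, by positivity, ?_⟩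
  intro w x x' r M hr hw hM hx'
  obtain ⟨v, hv, hvc, hvw⟩ := exists_contDiff_hasCompactSupport_eqOn_closedBall (by positivity) hw
  have hvcont := hv.continuous
  -- `x' = x + r e`, and the kernel centred at `x'` is the one at `x` translated by `e`.
  set e : E := r⁻¹ • (x' - x) with he
  have hre : r • e = x' - x := by rw [he, smul_smul, mul_inv_cancel₀ hr.ne', one_smul]
  have hen : ‖e‖ = ‖x' - x‖ / r := by
    rw [he, norm_smul, norm_inv, Real.norm_of_nonneg hr.le]; field_simp
  have hx'r : ‖x' - x‖ ≤ r := by rwa [mem_closedBall, dist_eq_norm] at hx'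
  have he1 : ‖e‖ ≤ 1 := by rw [hen, div_le_one hr]; exact hx'r
  have hmem : ∀ y : E, ‖y‖ ≤ 2 → x + r • y ∈ closedBall x (2 * r) := by
    intro y hy
    rw [mem_closedBall, dist_self_add_left, norm_smul, Real.norm_of_nonneg hr.le]
    nlinarith
  have h1 : ∫ y : E, radialKernel y * v (x + r • y) = m * w x := by
    rw [← (hw.mono (closedBall_subset_closedBall (by linarith))).integral_radialKernel_mul hr]
    congr 1; ext y
    rcases lt_or_ge ‖y‖ 1 with hy | hy
    · rw [(hvw _ (hmem y (by linarith))).1]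
    · rw [radialKernel_of_one_le hy]; simp
  have h2 : ∫ y : E, radialKernel (y - e) * v (x + r • y) = m * w x' := by
    have hsub : closedBall x' r ⊆ closedBall x (2 * r) := by
      apply closedBall_subset_closedBall'
      rw [dist_eq_norm]; linarith
    rw [← (hw.mono hsub).integral_radialKernel_mul hr]
    rw [← integral_sub_right_eq_self (fun y : E => radialKernel y * w (x' + r • y)) e]
    congr 1; ext y
    rcases lt_or_ge ‖y - e‖ 1 with hy | hy
    · have : ‖y‖ ≤ 2 := by
        have := norm_le_insert' y e
        linarith
      rw [(hvw _ (hmem y this)).1, smul_sub, hre]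
      congr 2; abel
    · rw [radialKernel_of_one_le hy]; simp
  have hint1 := integrable_radialKernel_mul (g := fun y : E => v (x + r • y)) (by fun_prop)
  have hint2 : Integrable fun y : E => radialKernel (y - e) * v (x + r • y) := by
    have := (integrable_radialKernel_mul (g := fun y : E => v (x + r • (y + e)))
      (by fun_prop)).comp_sub_right e
    simpa using this
  have hdiff : ∫ y : E, (radialKernel (y - e) - radialKernel y) * v (x + r • y) =
      m * (w x' - w x) := by
    simp only [sub_mul]
    rw [integral_sub hint2 hint1, h1, h2]; ring
  have hzero : ∀ y ∉ closedBall (0 : E) 2,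
      (radialKernel (y - e) - radialKernel y) * v (x + r • y) = 0 := by
    intro y hy
    rw [mem_closedBall_zero_iff, not_le] at hy
    have := norm_le_insert' y e
    rw [radialKernel_of_one_le (by linarith), radialKernel_of_one_le (y := y) (by linarith)]
    simp
  have hbound : ∀ y ∈ closedBall (0 : E) 2,
      ‖(radialKernel (y - e) - radialKernel y) * v (x + r • y)‖ ≤ 5 * ‖e‖ * M := by
    intro y hy
    rw [mem_closedBall_zero_iff] at hy
    rw [norm_mul, (hvw _ (hmem y hy)).1]
    have hk : ‖radialKernel (y - e) - radialKernel y‖ ≤ 5 * ‖e‖ := by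
      refine (abs_max_sub_max_le_abs _ _ _).trans ?_
      have ht : |‖y‖ - ‖y - e‖| ≤ ‖e‖ := by
        simpa using abs_norm_sub_norm_le y (y - e)
      have h3 : ‖y - e‖ ≤ 3 := (norm_sub_le _ _).trans (by linarith)
      have : 1 - ‖y - e‖ ^ 2 - (1 - ‖y‖ ^ 2) = (‖y‖ - ‖y - e‖) * (‖y‖ + ‖y - e‖) := by ring
      rw [this, abs_mul, abs_of_nonneg (a := ‖y‖ + ‖y - e‖) (by positivity), mul_comm]
      gcongr
      linarith
    exact mul_le_mul hk (hM _ (hmem y hy)) (abs_nonneg _) (by positivity)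
  rw [← setIntegral_eq_integral_of_forall_compl_eq_zero hzero] at hdiff
  have hfin := norm_setIntegral_le_of_norm_le_const (μ := (volume : Measure E))
    (measure_closedBall_lt_top) hbound
  rw [hdiff, norm_mul, Real.norm_of_nonneg hm.le, Real.norm_eq_abs, hen] at hfin
  have : |w x' - w x| ≤ 5 * (‖x' - x‖ / r) * M * volume.real (closedBall (0 : E) 2) / m := by
    rw [le_div_iff₀ hm]; linarith
  refine this.trans_eq ?_
  field_simp

/-- Interior gradient estimate for harmonic functions. -/
theorem exists_norm_fderiv_le_of_harmonicOnNhd (E : Type*) [NormedAddCommGroup E]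
    [InnerProductSpace ℝ E] [FiniteDimensional ℝ E] [MeasurableSpace E] [BorelSpace E] :
    ∃ C : ℝ, 0 < C ∧ ∀ (w : E → ℝ) (x : E) (r M : ℝ), 0 < r →
      InnerProductSpace.HarmonicOnNhd w (closedBall x r) →
      (∀ z ∈ closedBall x r, |w z| ≤ M) → ‖fderiv ℝ w x‖ ≤ C * M / r := by
  obtain ⟨C, hC, h⟩ := exists_abs_sub_le_of_harmonicOnNhd E
  refine ⟨2 * C, by positivity, ?_⟩
  intro w x r M hr hw hM
  have hr2 : 2 * (r / 2) = r := by ring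
  have hM0 : 0 ≤ M := (abs_nonneg _).trans (hM x (mem_closedBall_self hr.le))
  refine norm_fderiv_le_of_lip' ℝ (by positivity) ?_
  filter_upwards [closedBall_mem_nhds x (half_pos hr)] with x' hx'
  have := h w x x' (r / 2) M (half_pos hr) (by rwa [hr2]) (by rwa [hr2]) hx'
  rw [Real.norm_eq_abs]
  refine this.trans_eq ?_
  field_simp

/-- The local form of the strong maximum principle. -/
lemma InnerProductSpace.HarmonicOnNhd.eq_of_forall_le {u : E → ℝ} {x : E} {R : ℝ} (hR : 0 < R)
    (hu : InnerProductSpace.HarmonicOnNhd u (closedBall x R))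
    (hmax : ∀ z ∈ closedBall x R, u z ≤ u x) : ∀ z ∈ ball x R, u z = u x := by
  obtain ⟨v, hv, hvc, hvu⟩ := exists_contDiff_hasCompactSupport_eqOn_closedBall hR hu
  have hvcont := hv.continuous
  have hmem : ∀ y : E, ‖y‖ ≤ 1 → x + R • y ∈ closedBall x R := by
    intro y hy
    rw [mem_closedBall, dist_self_add_left, norm_smul, Real.norm_of_nonneg hR.le]
    nlinarith
  have h0 : ∫ y : E, radialKernel y * (u x - v (x + R • y)) = 0 := by
    simp only [mul_sub]
    rw [integral_sub (integrable_radialKernel_mul continuous_const)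
      (integrable_radialKernel_mul (by fun_prop)), integral_mul_const,
      ← hu.integral_radialKernel_mul hR, sub_eq_zero]
    congr 1; ext y
    rcases lt_or_ge ‖y‖ 1 with hy | hy
    · rw [(hvu _ (hmem y hy.le)).1]
    · rw [radialKernel_of_one_le hy]; simp
  intro z hz
  by_contra hne
  rw [mem_ball, dist_eq_norm] at hz
  set y : E := R⁻¹ • (z - x) with hy
  have hRy : x + R • y = z := by rw [hy, smul_smul, mul_inv_cancel₀ hR.ne', one_smul]; abel
  have hyn : ‖y‖ < 1 := by
    rw [hy, norm_smul, norm_inv, Real.norm_of_nonneg hR.le, inv_mul_lt_iff₀ hR]; linarith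
  have hpos := Continuous.integral_pos_of_hasCompactSupport_nonneg_nonzero
    (μ := (volume : Measure E)) (f := fun y : E => radialKernel y * (u x - v (x + R • y)))
    (continuous_radialKernel.mul (by fun_prop)) hasCompactSupport_radialKernel.mul_right
    (fun y' => ?_) (x := y) ?_
  · exact hpos.ne' h0
  · simp only [Pi.zero_apply]
    rcases lt_or_ge ‖y'‖ 1 with h | h
    · rw [(hvu _ (hmem y' h.le)).1]
      exact mul_nonneg (radialKernel_nonneg _) (sub_nonneg.2 (hmax _ (hmem y' h.le)))
    · rw [radialKernel_of_one_le h]; simp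
  · rw [(hvu _ (hmem y hyn.le)).1, hRy]
    exact mul_ne_zero (radialKernel_pos hyn).ne' (sub_ne_zero.2 (Ne.symm hne))

end MeanValue

/-! ### Curves transversal to the sphere fill a collar -/

namespace TransLip

variable {n : ℕ} {a : ℝ} {Γ : EuclideanSpace ℝ (Fin n) → ℝ → EuclideanSpace ℝ (Fin n)}

/-- The extension of a family of curves that is constant along rays in the first variable. It is
defined near the sphere in the whole space, so that ordinary derivatives can be used. -/
noncomputable def radialExtension
    (Γ : EuclideanSpace ℝ (Fin n) → ℝ → EuclideanSpace ℝ (Fin n))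
    (z : EuclideanSpace ℝ (Fin n) × ℝ) : EuclideanSpace ℝ (Fin n) :=
  Γ (‖z.1‖⁻¹ • z.1) z.2

lemma radialExtension_of_mem_sphere {q : EuclideanSpace ℝ (Fin n)} (hq : q ∈ sphere 0 1) (t : ℝ) :
    radialExtension Γ (q, t) = Γ q t := by
  rw [mem_sphere_zero_iff_norm] at hq
  simp [radialExtension, hq]

lemma IsTransversalFamily.contDiffAt_radialExtension (hΓ : IsTransversalFamily a Γ)
    {p : EuclideanSpace ℝ (Fin n)} (hp : p ∈ sphere 0 1) {t : ℝ} (ht : t ∈ Ioo (-a) a) :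
    ContDiffAt ℝ 2 (radialExtension Γ) (p, t) := by
  have hp1 : ‖p‖ = 1 := by simpa using hp
  have hp0 : p ≠ 0 := by rintro rfl; simp at hp1
  let N : EuclideanSpace ℝ (Fin n) × ℝ → EuclideanSpace ℝ (Fin n) × ℝ :=
    fun z => (‖z.1‖⁻¹ • z.1, z.2)
  have hN : ContDiffAt ℝ 2 N (p, t) := by
    have h1 : ContDiffAt ℝ 2 (fun z : EuclideanSpace ℝ (Fin n) × ℝ => ‖z.1‖) (p, t) :=
      contDiffAt_fst.norm ℝ hp0
    exact ((h1.inv (by simpa using hp0)).smul contDiffAt_fst).prodMk contDiffAt_snd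
  have hNp : N (p, t) = (p, t) := by simp [N, hp1]
  set s : Set (EuclideanSpace ℝ (Fin n) × ℝ) := {0}ᶜ ×ˢ Ioo (-a) a with hs
  have hmaps : MapsTo N s (sphere 0 1 ×ˢ Ioo (-a) a) := by
    rintro z ⟨hz1, hz2⟩
    refine ⟨?_, hz2⟩
    have : ‖z.1‖ ≠ 0 := by simpa using hz1
    simp [N, norm_smul, this]
  have hmem : s ∈ 𝓝 (p, t) :=
    (isOpen_compl_singleton.prod isOpen_Ioo).mem_nhds ⟨by simpa using hp0, ht⟩
  have hc := hΓ.contDiffOn (N (p, t)) (by rw [hNp]; exact ⟨hp, ht⟩)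
  exact (hc.comp (p, t) hN.contDiffWithinAt hmaps).contDiffAt hmem

lemma IsTransversalFamily.hasDerivAt (hΓ : IsTransversalFamily a Γ)
    {q : EuclideanSpace ℝ (Fin n)} (hq : q ∈ sphere 0 1) {t : ℝ} (ht : t ∈ Ioo (-a) a) :
    HasDerivAt (Γ q) (fderiv ℝ (radialExtension Γ) (q, t) (0, 1)) t := by
  have h1 := ((hΓ.contDiffAt_radialExtension hq ht).differentiableAt (by norm_num)).hasFDerivAt
  have h2 : HasDerivAt (fun s : ℝ => (q, s)) ((0 : EuclideanSpace ℝ (Fin n)), (1 : ℝ)) t :=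
    (hasDerivAt_const t q).prodMk (hasDerivAt_id t)
  have h3 := h1.comp_hasDerivAt t h2
  exact h3.congr_of_eventuallyEq
    (Eventually.of_forall fun s => (radialExtension_of_mem_sphere hq s).symm)

/-- At non-positive times the curves are outside the open ball. -/
lemma IsTransversalFamily.one_le_norm (hΓ : IsTransversalFamily a Γ)
    {q : EuclideanSpace ℝ (Fin n)} (hq : q ∈ sphere 0 1) {t : ℝ} (hta : -a < t) (ht : t ≤ 0) :
    1 ≤ ‖Γ q t‖ := by
  obtain ⟨c, hc, htr⟩ := hΓ.transversal
  have hq1 : ‖q‖ = 1 := by simpa using hq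
  have ha := hΓ.pos
  have hder : ∀ s ∈ Icc t 0, HasDerivAt (fun s => inner ℝ (Γ q s) q)
      (inner ℝ (deriv (Γ q) s) q) s := by
    intro s hs
    have h := hΓ.hasDerivAt hq (t := s) ⟨by linarith [hs.1], by linarith [hs.2]⟩
    rw [h.deriv]
    simpa using h.inner ℝ (hasDerivAt_const s q)
  have hanti : AntitoneOn (fun s => inner ℝ (Γ q s) q) (Icc t 0) := by
    refine antitoneOn_of_deriv_nonpos (convex_Icc t 0)
      (fun s hs => (hder s hs).continuousAt.continuousWithinAt)
      (fun s hs => ((hder s (interior_subset hs)).differentiableAt).differentiableWithinAt) ?_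
    intro s hs
    have hs' := interior_subset hs
    rw [(hder s hs').deriv]
    have := htr q hq s ⟨by linarith [hs'.1], by linarith [hs'.2]⟩
    linarith
  have h1 := hanti (left_mem_Icc.2 ht) (right_mem_Icc.2 ht) ht
  simp only [hΓ.initial q hq, real_inner_self_eq_norm_sq, hq1] at h1
  have h2 := real_inner_le_norm (Γ q t) q
  rw [hq1] at h2
  linarith

lemma hasFDerivAt_norm_of_norm_eq_one {E : Type*} [NormedAddCommGroup E] [InnerProductSpace ℝ E]
    {p : E} (hp : ‖p‖ = 1) : HasFDerivAt (fun y : E => ‖y‖) (innerSL ℝ p) p := by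
  have := (hasStrictFDerivAt_norm_sq p).hasFDerivAt.sqrt (by simp [hp])
  simp only [Real.sqrt_sq (norm_nonneg _)] at this
  refine this.congr_fderiv ?_
  ext z
  simp [hp]

lemma hasFDerivAt_inv_norm_smul {E : Type*} [NormedAddCommGroup E] [InnerProductSpace ℝ E] {p : E}
    (hp : ‖p‖ = 1) :
    HasFDerivAt (fun y : E => ‖y‖⁻¹ • y)
      (ContinuousLinearMap.id ℝ E - (innerSL ℝ p).smulRight p) p := by
  have h1 := hasFDerivAt_norm_of_norm_eq_one hp
  have h2 := (hasDerivAt_inv (x := ‖p‖) (by simp [hp])).comp_hasFDerivAt p h1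
  refine (h2.smul (hasFDerivAt_id p)).congr_fderiv ?_
  ext z
  simp [hp, sub_eq_add_neg]

/-- The collar map `y ↦ Γ(y / |y|, 1 - |y|)`. It fixes the unit sphere. -/
noncomputable def collarMap (Γ : EuclideanSpace ℝ (Fin n) → ℝ → EuclideanSpace ℝ (Fin n))
    (y : EuclideanSpace ℝ (Fin n)) : EuclideanSpace ℝ (Fin n) :=
  radialExtension Γ (y, 1 - ‖y‖)

lemma IsTransversalFamily.collarMap_of_mem_sphere (hΓ : IsTransversalFamily a Γ)
    {p : EuclideanSpace ℝ (Fin n)} (hp : p ∈ sphere 0 1) : collarMap Γ p = p := by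
  have hp1 : ‖p‖ = 1 := by simpa using hp
  rw [collarMap, radialExtension_of_mem_sphere hp, hp1, sub_self, hΓ.initial p hp]

/-- By transversality the derivative of the collar map is invertible at points of the sphere. -/
lemma IsTransversalFamily.exists_hasStrictFDerivAt_collarMap (hΓ : IsTransversalFamily a Γ)
    {p : EuclideanSpace ℝ (Fin n)} (hp : p ∈ sphere 0 1) :
    ∃ A : EuclideanSpace ℝ (Fin n) ≃L[ℝ] EuclideanSpace ℝ (Fin n),
      HasStrictFDerivAt (collarMap Γ) (A : EuclideanSpace ℝ (Fin n) →L[ℝ] _) p := by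
  have hp1 : ‖p‖ = 1 := by simpa using hp
  have hp0 : p ≠ 0 := by rintro rfl; simp at hp1
  have h0 : (0 : ℝ) ∈ Ioo (-a) a := by simp [hΓ.pos]
  have hF := hΓ.contDiffAt_radialExtension hp h0
  set D := fderiv ℝ (radialExtension Γ) (p, 0) with hD
  have hFD : HasFDerivAt (radialExtension Γ) D (p, 0) :=
    (hF.differentiableAt (by norm_num)).hasFDerivAt
  obtain ⟨c, hc, htr⟩ := hΓ.transversal
  have hnorm := hasFDerivAt_norm_of_norm_eq_one hp1
  have hpair : HasFDerivAt (fun y : EuclideanSpace ℝ (Fin n) => (y, 1 - ‖y‖))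
      ((ContinuousLinearMap.id ℝ _).prod (-(innerSL ℝ p))) p :=
    (hasFDerivAt_id p).prodMk (hnorm.const_sub 1)
  have hsmooth : ContDiffAt ℝ 2 (collarMap Γ) p := by
    have h1 : ContDiffAt ℝ 2 (fun y : EuclideanSpace ℝ (Fin n) => (y, 1 - ‖y‖)) p :=
      contDiffAt_id.prodMk (contDiffAt_const.sub (contDiffAt_id.norm ℝ hp0))
    refine ContDiffAt.comp (g := radialExtension Γ) p ?_ h1
    simpa [hp1] using hF
  set L := D.comp ((ContinuousLinearMap.id ℝ _).prod (-(innerSL ℝ p))) with hL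
  have hΦ : HasFDerivAt (collarMap Γ) L p := by
    refine HasFDerivAt.comp (g := radialExtension Γ) p ?_ hpair
    simpa [hp1] using hFD
  have hstrict : HasStrictFDerivAt (collarMap Γ) L p := by
    have := hsmooth.hasStrictFDerivAt (by norm_num)
    rwa [hΦ.fderiv] at this
  -- `D` is known on the two factors: the radial projection on the first, `γ_p'(0)` on the second.
  have hD1 : ∀ v, D (v, 0) = v - inner ℝ p v • p := by
    have h1 : HasFDerivAt (fun y : EuclideanSpace ℝ (Fin n) => radialExtension Γ (y, 0))
        (D.comp ((ContinuousLinearMap.id ℝ _).prod 0)) p :=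
      HasFDerivAt.comp (g := radialExtension Γ)
        (f := fun y : EuclideanSpace ℝ (Fin n) => (y, (0 : ℝ))) p hFD
        ((hasFDerivAt_id p).prodMk (hasFDerivAt_const (0 : ℝ) p))
    have h2 : (fun y : EuclideanSpace ℝ (Fin n) => radialExtension Γ (y, 0)) =ᶠ[𝓝 p]
        fun y => ‖y‖⁻¹ • y := by
      filter_upwards [isOpen_compl_singleton.mem_nhds (show p ∈ ({0}ᶜ : Set _) by simpa)] with y hy
      have hy' : ‖y‖ ≠ 0 := by simpa using hy
      refine hΓ.initial _ ?_
      simp [norm_smul, hy']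
    have h3 := (h1.congr_of_eventuallyEq h2.symm).unique (hasFDerivAt_inv_norm_smul hp1)
    intro v
    simpa using congrArg (fun T => T v) h3
  have hD2 : inner ℝ (D (0, 1)) p ≤ -c := by
    have := htr p hp 0 h0
    rwa [(hΓ.hasDerivAt hp h0).deriv] at this
  have hLv : ∀ v, L v = v - inner ℝ p v • p - inner ℝ p v • D (0, 1) := by
    intro v
    have h1 : L v = D (v, -inner ℝ p v) := by simp [hL]
    have h2 : (v, -inner ℝ p v) = (v, (0 : ℝ)) - (inner ℝ p v) • ((0 : _), (1 : ℝ)) := by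
      ext <;> simp
    rw [h1, h2, map_sub, map_smul, hD1]
  have hinj : Function.Injective (L : EuclideanSpace ℝ (Fin n) →ₗ[ℝ] EuclideanSpace ℝ (Fin n)) := by
    rw [injective_iff_map_eq_zero]
    intro v hv
    have hv' : v - inner ℝ p v • p - inner ℝ p v • D (0, 1) = 0 := by rw [← hLv]; exact hv
    have h1 : inner ℝ p v * inner ℝ (D (0, 1)) p = 0 := by
      have := congrArg (fun w => inner ℝ w p) hv'
      simp only [inner_sub_left, real_inner_smul_left, inner_zero_left,
        real_inner_self_eq_norm_sq, hp1] at this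
      rw [real_inner_comm p v] at this
      linarith
    have h2 : inner ℝ p v = 0 := by
      rcases mul_eq_zero.1 h1 with h | h
      · exact h
      · rw [h] at hD2; linarith
    simpa [h2] using hv'
  refine ⟨(LinearEquiv.ofInjectiveEndo _ hinj).toContinuousLinearEquiv, ?_⟩
  convert hstrict using 1
  ext1 v
  rfl

/-- The quantitative form, at `p`, of the statement that the curves fill a collar: a point `x` of
the ball near `p` lies on a curve, at a time and with a base point controlled by `|x - p|`, and
that curve continues from `x` like the line with direction `γ_p'(0)`. -/
def CollarBound (Γ : EuclideanSpace ℝ (Fin n) → ℝ → EuclideanSpace ℝ (Fin n)) (K : ℝ)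
    (p : EuclideanSpace ℝ (Fin n)) : Prop :=
  ‖deriv (Γ p) 0‖ ≤ K ∧ ∀ x ∈ ball (0 : EuclideanSpace ℝ (Fin n)) 1, ‖x - p‖ < 1 / K →
    ∃ q ∈ sphere (0 : EuclideanSpace ℝ (Fin n)) 1, ∃ t : ℝ, 0 < t ∧ t ≤ K * ‖x - p‖ ∧ Γ q t = x ∧
      ∀ s : ℝ, 0 ≤ s → s ≤ 1 / K →
        ‖Γ q (t + s) - (x + s • deriv (Γ p) 0)‖ ≤ K * s * (‖x - p‖ + s)

lemma CollarBound.mono {K K' : ℝ} {p : EuclideanSpace ℝ (Fin n)} (hK : 0 < K) (hKK' : K ≤ K')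
    (h : CollarBound Γ K p) : CollarBound Γ K' p := by
  have hinv : 1 / K' ≤ 1 / K := one_div_le_one_div_of_le hK hKK'
  refine ⟨h.1.trans hKK', fun x hx hxp => ?_⟩
  obtain ⟨q, hq, t, ht, htK, hqt, hs⟩ := h.2 x hx (hxp.trans_le hinv)
  refine ⟨q, hq, t, ht, htK.trans (by gcongr), hqt, fun s hs0 hs1 => ?_⟩
  exact (hs s hs0 (hs1.trans hinv)).trans (by gcongr)

lemma IsTransversalFamily.norm_sub_le_of_lipschitzOnWith (hΓ : IsTransversalFamily a Γ)
    {L : NNReal} {W : Set (EuclideanSpace ℝ (Fin n) × ℝ)}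
    (hLip : LipschitzOnWith L (fderiv ℝ (radialExtension Γ)) W)
    {p q : EuclideanSpace ℝ (Fin n)} (hp : p ∈ sphere 0 1) (hq : q ∈ sphere 0 1) {t s R : ℝ}
    (hs : 0 ≤ s) (hpW : (p, 0) ∈ W) (hqW : ∀ σ ∈ Icc 0 s, (q, t + σ) ∈ W ∧ t + σ ∈ Ioo (-a) a)
    (hR : ∀ σ ∈ Icc 0 s, ‖(q, t + σ) - (p, 0)‖ ≤ R) :
    ‖Γ q (t + s) - (Γ q t + s • deriv (Γ p) 0)‖ ≤ L * R * s := by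
  set D := fderiv ℝ (radialExtension Γ) with hD
  have hV : deriv (Γ p) 0 = D (p, 0) (0, 1) := (hΓ.hasDerivAt hp (by simp [hΓ.pos])).deriv
  have hunit : ‖((0 : EuclideanSpace ℝ (Fin n)), (1 : ℝ))‖ = 1 := by simp [Prod.norm_def]
  have hder : ∀ σ ∈ Icc 0 s, HasDerivWithinAt (fun σ => Γ q (t + σ) - σ • deriv (Γ p) 0)
      (D (q, t + σ) (0, 1) - deriv (Γ p) 0) (Icc 0 s) σ := by
    intro σ hσ
    have h1 := hΓ.hasDerivAt hq (hqW σ hσ).2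
    have h2 := h1.comp_const_add t σ
    have h3 := (hasDerivAt_id σ).smul_const (deriv (Γ p) 0)
    rw [one_smul] at h3
    exact (h2.sub h3).hasDerivWithinAt
  have hbd : ∀ σ ∈ Ico 0 s, ‖D (q, t + σ) (0, 1) - deriv (Γ p) 0‖ ≤ L * R := by
    intro σ hσ
    have hσ' := Ico_subset_Icc_self hσ
    have h1 := hLip.norm_sub_le (hqW σ hσ').1 hpW
    rw [hV, ← sub_apply]
    refine (ContinuousLinearMap.le_opNorm _ _).trans ?_
    rw [hunit, mul_one]
    exact h1.trans (mul_le_mul_of_nonneg_left (hR σ hσ') L.2)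
  have hfin := norm_image_sub_le_of_norm_deriv_le_segment' hder hbd s ⟨hs, le_rfl⟩
  simp only [add_zero, zero_smul, sub_zero] at hfin
  have heq : Γ q (t + s) - (Γ q t + s • deriv (Γ p) 0) =
      Γ q (t + s) - s • deriv (Γ p) 0 - Γ q t := by abel
  rwa [heq]

set_option maxHeartbeats 800000 in
lemma IsTransversalFamily.eventually_collarBound (hΓ : IsTransversalFamily a Γ)
    {p₀ : EuclideanSpace ℝ (Fin n)} (hp₀ : p₀ ∈ sphere 0 1) :
    ∃ K : ℝ, 0 < K ∧ ∀ᶠ p in 𝓝[sphere 0 1] p₀, CollarBound Γ K p := by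
  have ha := hΓ.pos
  have h0 : (0 : ℝ) ∈ Ioo (-a) a := by simp [ha]
  have hF := hΓ.contDiffAt_radialExtension hp₀ h0
  set D := fderiv ℝ (radialExtension Γ) with hD
  obtain ⟨L, W, hW, hLip⟩ := (hF.fderiv_right (m := 1) (by norm_num)).exists_lipschitzOnWith
  obtain ⟨η₀, hη₀, hη₀W⟩ := Metric.mem_nhds_iff.1 hW
  set η := min η₀ (min a 1) with hη
  have hηpos : 0 < η := by positivity
  have hηa : η ≤ a := (min_le_right _ _).trans (min_le_left _ _)
  have hη1 : η ≤ 1 := (min_le_right _ _).trans (min_le_right _ _)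
  have hηW : ∀ q t, ‖q - p₀‖ < η → |t| < η → (q, t) ∈ W := by
    intro q t hq ht
    refine hη₀W ?_
    rw [mem_ball, Prod.dist_eq]
    refine max_lt ?_ ?_
    · rw [dist_eq_norm]; exact hq.trans_le (min_le_left _ _)
    · simpa using ht.trans_le (min_le_left _ _)
  obtain ⟨A, hA⟩ := hΓ.exists_hasStrictFDerivAt_collarMap hp₀
  set g := hA.localInverse (collarMap Γ) A p₀ with hg
  have hfix := hΓ.collarMap_of_mem_sphere hp₀
  obtain ⟨K₁, U, hU, hgLip⟩ := hA.to_localInverse.exists_lipschitzOnWith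
  have hright := hA.eventually_right_inverse
  have hleft := hA.eventually_left_inverse
  have hcont := hA.localInverse_tendsto
  rw [hfix] at hU hright hcont
  obtain ⟨ρ, hρ, hρball⟩ := Metric.eventually_nhds_iff_ball.1
    ((eventually_mem_set.2 hU).and (hright.and (hleft.and
      (hcont.eventually (ball_mem_nhds p₀ (show 0 < η / 4 by positivity))))))
  -- Each summand of `K` serves one of the bounds below.
  set K : ℝ := 1 + 2 / ρ + 2 / η + K₁ + L * (3 * K₁ + 1) + ‖D (p₀, 0)‖ + L * η with hK
  have hK₁ : (0 : ℝ) ≤ K₁ := K₁.2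
  have hL0 : (0 : ℝ) ≤ L := L.2
  have hb1 : 0 < 2 / ρ := by positivity
  have hb2 : 0 < 2 / η := by positivity
  have hb3 : 0 ≤ L * (3 * K₁ + 1 : ℝ) := by positivity
  have hb4 : 0 ≤ L * η := by positivity
  have hb5 := norm_nonneg (D (p₀, 0))
  have hKpos : 0 < K := by positivity
  have hKρ : 1 / K ≤ ρ / 2 := by
    rw [div_le_iff₀ hKpos]
    calc 1 = ρ / 2 * (2 / ρ) := by field_simp
      _ ≤ ρ / 2 * K := by gcongr; linarith
  have hKη : 1 / K ≤ η / 2 := by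
    rw [div_le_iff₀ hKpos]
    calc 1 = η / 2 * (2 / η) := by field_simp
      _ ≤ η / 2 * K := by gcongr; linarith
  refine ⟨K, hKpos, ?_⟩
  have hm : 0 < min (ρ / 2) η := by positivity
  filter_upwards [self_mem_nhdsWithin, nhdsWithin_le_nhds (ball_mem_nhds p₀ hm)] with p hp hpp₀
  rw [mem_ball, dist_eq_norm] at hpp₀
  have hpρ : ‖p - p₀‖ < ρ / 2 := hpp₀.trans_le (min_le_left _ _)
  have hpη : ‖p - p₀‖ < η := hpp₀.trans_le (min_le_right _ _)
  have hp1 : ‖p‖ = 1 := by simpa using hp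
  have hp₀1 : ‖p₀‖ = 1 := by simpa using hp₀
  have hV : deriv (Γ p) 0 = D (p, 0) (0, 1) := (hΓ.hasDerivAt hp h0).deriv
  have hunit : ‖((0 : EuclideanSpace ℝ (Fin n)), (1 : ℝ))‖ = 1 := by simp [Prod.norm_def]
  refine ⟨?_, fun x hx hxp => ?_⟩
  · rw [hV]
    have h1 := hLip.norm_sub_le (hηW p 0 hpη (by simpa)) (hηW p₀ 0 (by simpa) (by simpa))
    have h2 : ‖(p, (0 : ℝ)) - (p₀, 0)‖ ≤ η := by
      simp [Prod.norm_def, hpη.le]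
    have h3 := (D (p, 0)).le_opNorm (0, 1)
    rw [hunit, mul_one] at h3
    have h4 := norm_le_insert' (D (p, 0)) (D (p₀, 0))
    have h5 : (L : ℝ) * ‖(p, (0 : ℝ)) - (p₀, 0)‖ ≤ L * η := by gcongr
    linarith
  · have hxρ : x ∈ ball p₀ ρ := by
      rw [mem_ball, dist_eq_norm]
      have := norm_sub_le_norm_sub_add_norm_sub x p p₀
      linarith
    have hpball : p ∈ ball p₀ ρ := by rw [mem_ball, dist_eq_norm]; linarith
    obtain ⟨hxU, hxr, -, hxg⟩ := hρball x hxρ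
    obtain ⟨hpU, -, hpl, -⟩ := hρball p hpball
    rw [hΓ.collarMap_of_mem_sphere hp] at hpl
    set y := g x with hy
    have hyp : ‖y - p‖ ≤ K₁ * ‖x - p‖ := by
      have := hgLip.norm_sub_le hxU hpU
      rwa [hpl] at this
    have hyp₀ : ‖y - p₀‖ < η / 4 := by rwa [← dist_eq_norm]
    have habs : ∀ z : EuclideanSpace ℝ (Fin n), ‖z‖ = 1 → |1 - ‖y‖| ≤ ‖y - z‖ := by
      intro z hz
      rw [← hz, abs_sub_comm]; exact abs_norm_sub_norm_le y z
    have hy0 : ‖y‖ ≠ 0 := by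
      intro h
      have := habs p₀ hp₀1
      rw [h] at this
      norm_num at this
      linarith
    -- In the polar coordinates of the collar map, `y` gives the base point and the time.
    set q := ‖y‖⁻¹ • y with hq
    set t := 1 - ‖y‖ with ht
    have hqS : q ∈ sphere (0 : EuclideanSpace ℝ (Fin n)) 1 := by simp [hq, norm_smul, hy0]
    have hqt : Γ q t = x := hxr
    have hqy : ‖q - y‖ = |t| := by
      have : q - y = (‖y‖⁻¹ * (1 - ‖y‖)) • y := by
        rw [hq, mul_sub, mul_one, inv_mul_cancel₀ hy0, sub_smul, one_smul]
      rw [this, norm_smul, norm_mul, norm_inv, norm_norm, ← ht, Real.norm_eq_abs, mul_right_comm,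
        inv_mul_cancel₀ hy0, one_mul]
    have htη : |t| < η / 4 := (habs p₀ hp₀1).trans_lt hyp₀
    have htp : |t| ≤ K₁ * ‖x - p‖ := (habs p hp1).trans hyp
    have hqp₀ : ‖q - p₀‖ < η := by
      have := norm_sub_le_norm_sub_add_norm_sub q y p₀
      linarith
    have hqp : ‖q - p‖ ≤ 2 * K₁ * ‖x - p‖ := by
      have := norm_sub_le_norm_sub_add_norm_sub q y p
      linarith
    have htpos : 0 < t := by
      by_contra hneg
      have := hΓ.one_le_norm hqS (t := t) (by linarith [neg_abs_le t]) (not_lt.1 hneg)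
      rw [hqt] at this
      rw [mem_ball_zero_iff] at hx
      linarith
    rw [abs_of_pos htpos] at htη htp
    refine ⟨q, hqS, t, htpos, htp.trans ?_, hqt, fun s hs0 hs1 => ?_⟩
    · gcongr; linarith
    have hsη : s ≤ η / 2 := hs1.trans hKη
    have hxp0 := norm_nonneg (x - p)
    have hfin := hΓ.norm_sub_le_of_lipschitzOnWith hLip hp hqS hs0 (hηW p 0 hpη (by simpa))
      (t := t) (R := (3 * K₁ + 1) * (‖x - p‖ + s)) (fun σ hσ => ⟨hηW q (t + σ) hqp₀
        (by rw [abs_of_nonneg (by linarith [hσ.1])]; linarith [hσ.2]),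
        by linarith [hσ.1], by linarith [hσ.2]⟩) ?_
    · rw [hqt] at hfin
      refine hfin.trans ?_
      have : L * (3 * K₁ + 1 : ℝ) ≤ K := by linarith
      calc L * ((3 * K₁ + 1) * (‖x - p‖ + s)) * s = L * (3 * K₁ + 1) * s * (‖x - p‖ + s) := by ring
        _ ≤ K * s * (‖x - p‖ + s) := by gcongr
    · intro σ hσ
      have := mul_nonneg hK₁ hxp0
      have := mul_nonneg hK₁ hs0
      have hexp : (3 * K₁ + 1) * (‖x - p‖ + s) =
          3 * (K₁ * ‖x - p‖) + ‖x - p‖ + 3 * (K₁ * s) + s := by ring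
      rw [hexp]
      refine max_le ?_ ?_
      · change ‖q - p‖ ≤ _
        linarith
      · change ‖t + σ - 0‖ ≤ _
        rw [sub_zero, Real.norm_of_nonneg (by linarith [hσ.1])]
        linarith [hσ.2]

/-- The collar bound holds with one constant, by compactness of the sphere. -/
theorem IsTransversalFamily.exists_collarBound (hΓ : IsTransversalFamily a Γ) :
    ∃ K : ℝ, 0 < K ∧ ∀ p ∈ sphere (0 : EuclideanSpace ℝ (Fin n)) 1, CollarBound Γ K p := by
  refine (isCompact_sphere (0 : EuclideanSpace ℝ (Fin n)) 1).induction_on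
    (p := fun T => ∃ K : ℝ, 0 < K ∧ ∀ p ∈ T, CollarBound Γ K p) ⟨1, one_pos, by simp⟩ ?_ ?_ ?_
  · rintro S T hST ⟨K, hK, h⟩
    exact ⟨K, hK, fun p hp => h p (hST hp)⟩
  · rintro S T ⟨K, hK, h⟩ ⟨K', hK', h'⟩
    refine ⟨K + K', by positivity, ?_⟩
    rintro p (hp | hp)
    · exact (h p hp).mono hK (by linarith)
    · exact (h' p hp).mono hK' (by linarith)
  · intro p₀ hp₀
    obtain ⟨K, hK, h⟩ := hΓ.eventually_collarBound hp₀
    exact ⟨_, h, K, hK, fun p hp => hp⟩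

end TransLip

/-! ### Consequences of the transversal Lipschitz condition -/

namespace TransLip

variable {n : ℕ} {a : ℝ} {Γ : EuclideanSpace ℝ (Fin n) → ℝ → EuclideanSpace ℝ (Fin n)}
  {B : ℝ → ℝ} {u : EuclideanSpace ℝ (Fin n) → ℝ}

/-- `u` changes by at most `C₀ B(h)` between a point `x` near a boundary point `p` and some point
`y` that is, up to an error of second order, `x + h V(p)`; both points are deeper in the ball than
`x`, by an amount proportional to `h`. This is all that the proof uses about the curves. -/
def InwardStepBound (B : ℝ → ℝ) (u : EuclideanSpace ℝ (Fin n) → ℝ)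
    (V : EuclideanSpace ℝ (Fin n) → EuclideanSpace ℝ (Fin n)) (κ ρ K C₀ : ℝ) : Prop :=
  ∀ p ∈ sphere (0 : EuclideanSpace ℝ (Fin n)) 1, ∀ x ∈ ball (0 : EuclideanSpace ℝ (Fin n)) 1,
    ‖x - p‖ ≤ ρ → ∀ h : ℝ, 0 < h → h ≤ ρ →
      ‖x + h • V p‖ ≤ ‖x‖ - 2 * κ * h ∧
        ∃ y, ‖y‖ ≤ ‖x‖ - κ * h ∧ ‖y - (x + h • V p)‖ ≤ K * h * (‖x - p‖ + h) ∧
          |u y - u x| ≤ C₀ * B h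

theorem exists_inwardStepBound (hΓ : IsTransversalFamily a Γ)
    (huΓ : IsTransversallyLipschitz B Γ u) :
    ∃ V κ ρ K C₀, 0 < κ ∧ 0 < ρ ∧ ρ ≤ 1 / 2 ∧ 0 < K ∧ 0 < C₀ ∧ InwardStepBound B u V κ ρ K C₀ := by
  obtain ⟨K, hK, hcollar⟩ := hΓ.exists_collarBound
  obtain ⟨c, hc, htr⟩ := hΓ.transversal
  obtain ⟨C₀, hC₀, ε, hε, hu⟩ := huΓ
  have h0 : (0 : ℝ) ∈ Ioo (-a) a := by simp [hΓ.pos]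
  obtain ⟨ρ, hρ, h1, h2, h3, h4, h5, h6⟩ : ∃ ρ : ℝ, 0 < ρ ∧ ρ ≤ 1 / 2 ∧ ρ * K < 1 ∧
      ρ * (2 * K) ≤ c / 4 ∧ ρ * (2 * K + K ^ 2) ≤ c ∧ ρ * c ≤ 1 ∧ ρ * (K + 1) < ε := by
    have key : ∀ s m : ℝ, 0 < m → ∀ᶠ ρ in 𝓝[>] (0 : ℝ), ρ * s < m := by
      intro s m hm
      have : Tendsto (fun ρ : ℝ => ρ * s) (𝓝[>] 0) (𝓝 (0 * s)) :=
        ((continuous_id.mul continuous_const).tendsto 0).mono_left nhdsWithin_le_nhds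
      rw [zero_mul] at this
      exact this.eventually_lt_const hm
    have hex := (eventually_mem_nhdsWithin (a := (0 : ℝ)) (s := Ioi 0)).and
      ((key 1 (1 / 2) (by norm_num)).and ((key K 1 one_pos).and
      ((key (2 * K) (c / 4) (by positivity)).and ((key (2 * K + K ^ 2) c hc).and
      ((key c 1 one_pos).and (key (K + 1) ε hε))))))
    obtain ⟨ρ, g0, g1, g2, g3, g4, g5, g6⟩ := hex.exists
    exact ⟨ρ, g0, by linarith, g2, g3.le, g4.le, g5.le, g6⟩
  refine ⟨fun p => deriv (Γ p) 0, c / 4, ρ, K, C₀, by positivity, hρ, h1, hK, hC₀, ?_⟩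
  intro p hp x hx hxp h hh hhρ
  set V := deriv (Γ p) 0 with hV
  obtain ⟨hVK, hcov⟩ := hcollar p hp
  have hp1 : ‖p‖ = 1 := by simpa using hp
  have hρK : ρ < 1 / K := by rw [lt_div_iff₀ hK]; exact h2
  obtain ⟨q, hq, t, ht, htK, hqt, hstep⟩ := hcov x hx (hxp.trans_lt hρK)
  have hxn : ‖x‖ < 1 := by simpa using hx
  have hxlow : 1 / 2 ≤ ‖x‖ := by
    have := norm_le_insert x p
    rw [hp1] at this
    linarith
  have hxh : ‖x + h • V‖ ≤ ‖x‖ - 2 * (c / 4) * h := by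
    have hin : inner ℝ x V ≤ -c + ρ * K := by
      have e1 : inner ℝ x V = inner ℝ V p + inner ℝ (x - p) V := by
        rw [inner_sub_left, real_inner_comm p V]; ring
      have e2 := htr p hp 0 h0
      have e3 := (real_inner_le_norm (x - p) V).trans
        (mul_le_mul hxp hVK (norm_nonneg _) hρ.le)
      rw [e1]; linarith
    have hsq : ‖x + h • V‖ ^ 2 ≤ ‖x‖ ^ 2 - h * c := by
      rw [norm_add_sq_real, real_inner_smul_right, norm_smul, Real.norm_of_nonneg hh.le]
      have e1 : (h * ‖V‖) ^ 2 ≤ h * (ρ * K ^ 2) := by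
        calc (h * ‖V‖) ^ 2 = h * (h * ‖V‖ ^ 2) := by ring
          _ ≤ h * (ρ * K ^ 2) := by gcongr
      have e2 : 2 * (h * inner ℝ x V) ≤ 2 * (h * (-c + ρ * K)) := by gcongr
      -- Of the decrease `2hc` of `|x|²`, half survives the two error terms.
      have e3 : h * (ρ * (2 * K + K ^ 2)) ≤ h * c := by gcongr
      linarith
    have hhc : h * c ≤ 1 := (mul_le_mul_of_nonneg_right hhρ hc.le).trans h5
    have hnn : 0 ≤ ‖x‖ - 2 * (c / 4) * h := by linarith
    refine (sq_le_sq₀ (norm_nonneg _) hnn).1 (hsq.trans ?_)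
    have : h * c * ‖x‖ ≤ h * c * 1 := by gcongr
    nlinarith [sq_nonneg (c * h)]
  refine ⟨hxh, Γ q (t + h), ?_⟩
  have hy := hstep h hh.le (hhρ.trans hρK.le)
  have hyn : ‖Γ q (t + h)‖ ≤ ‖x‖ - c / 4 * h := by
    have e1 := norm_le_insert' (Γ q (t + h)) (x + h • V)
    have e2 : K * h * (‖x - p‖ + h) ≤ K * h * (ρ + ρ) := by gcongr
    have e3 : h * (ρ * (2 * K)) ≤ h * (c / 4) := by gcongr
    linarith
  refine ⟨hyn, hy, ?_⟩
  have htε : t + h < ε := by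
    have : K * ‖x - p‖ ≤ K * ρ := by gcongr
    linarith
  have := hu q hq (t + h) ⟨by positivity, htε⟩ t ⟨ht, by linarith⟩
    (by rw [mem_ball_zero_iff]; nlinarith) (by rwa [hqt])
  rwa [add_sub_cancel_left, abs_of_pos hh, hqt] at this

/-- The radial projection of a nonzero point `x` of the ball to the sphere is at distance
`1 - |x|`. -/
lemma exists_mem_sphere_norm_sub_eq {x : EuclideanSpace ℝ (Fin n)} (hx0 : x ≠ 0) (hx : ‖x‖ ≤ 1) :
    ∃ p ∈ sphere (0 : EuclideanSpace ℝ (Fin n)) 1, ‖x - p‖ = 1 - ‖x‖ := by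
  have hn : ‖x‖ ≠ 0 := norm_ne_zero_iff.2 hx0
  refine ⟨‖x‖⁻¹ • x, by simp [norm_smul, hn], ?_⟩
  have : x - ‖x‖⁻¹ • x = (-(‖x‖⁻¹ * (1 - ‖x‖))) • x := by
    rw [mul_sub, mul_one, inv_mul_cancel₀ hn, neg_sub, sub_smul, one_smul]
  rw [this, norm_smul, norm_neg, norm_mul, norm_inv, norm_norm,
    Real.norm_of_nonneg (sub_nonneg.2 hx), mul_right_comm, inv_mul_cancel₀ hn, one_mul]

/-- Each value of `u` on the ball is `C₀ B(ρ)`-close to a value on a fixed smaller ball. -/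
lemma InwardStepBound.exists_norm_le {V κ ρ K C₀} (h : InwardStepBound B u V κ ρ K C₀)
    (hκ : 0 < κ) (hρ : 0 < ρ) (hρ1 : ρ ≤ 1 / 2) (hBρ : 0 ≤ C₀ * B ρ) :
    ∃ R : ℝ, 0 ≤ R ∧ R < 1 ∧ ∀ x ∈ ball (0 : EuclideanSpace ℝ (Fin n)) 1, ∃ y ∈ closedBall 0 R,
      |u y - u x| ≤ C₀ * B ρ := by
  refine ⟨max (1 - ρ) (1 - κ * ρ), le_max_of_le_left (by linarith),
    max_lt (by linarith) (by linarith [mul_pos hκ hρ]), fun x hx => ?_⟩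
  have hxn : ‖x‖ < 1 := by simpa using hx
  rcases le_or_gt ‖x‖ (1 - ρ) with hle | hlt
  · exact ⟨x, by simp [hle], by simpa using hBρ⟩
  · have hx0 : x ≠ 0 := by rintro rfl; simp at hlt; linarith
    obtain ⟨p, hp, hxp⟩ := exists_mem_sphere_norm_sub_eq hx0 hxn.le
    obtain ⟨-, y, hy, -, huy⟩ := h p hp x hx (by linarith) ρ hρ le_rfl
    refine ⟨y, ?_, huy⟩
    rw [mem_closedBall_zero_iff]
    exact le_max_of_le_right (by linarith)

lemma InwardStepBound.exists_abs_le {V κ ρ K C₀} (h : InwardStepBound B u V κ ρ K C₀)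
    (hκ : 0 < κ) (hρ : 0 < ρ) (hρ1 : ρ ≤ 1 / 2) (hBρ : 0 ≤ C₀ * B ρ)
    (hu : ContinuousOn u (ball 0 1)) :
    ∃ M : ℝ, 0 < M ∧ ∀ x ∈ ball (0 : EuclideanSpace ℝ (Fin n)) 1, |u x| ≤ M := by
  obtain ⟨R, hR0, hR1, hR⟩ := h.exists_norm_le hκ hρ hρ1 hBρ
  obtain ⟨M, hM⟩ := (isCompact_closedBall (0 : EuclideanSpace ℝ (Fin n)) R).exists_bound_of_continuousOn
    (hu.mono (closedBall_subset_ball hR1))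
  have hM0 : 0 ≤ M := (norm_nonneg _).trans (hM 0 (mem_closedBall_self hR0))
  refine ⟨M + C₀ * B ρ + 1, by positivity, fun x hx => ?_⟩
  obtain ⟨y, hy, hyx⟩ := hR x hx
  have h1 := hM y hy
  rw [Real.norm_eq_abs] at h1
  have h2 := abs_sub_abs_le_abs_sub (u x) (u y)
  rw [abs_sub_comm] at h2
  linarith

/-- If `B` vanishes then `u` takes all its values on a smaller compact ball, hence attains its
maximum and is constant. -/
lemma InwardStepBound.eq_of_eq_zero {V κ ρ K C₀} (h : InwardStepBound B u V κ ρ K C₀)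
    (hκ : 0 < κ) (hρ : 0 < ρ) (hρ1 : ρ ≤ 1 / 2) (hB : B ρ = 0)
    (hu : InnerProductSpace.HarmonicOnNhd u (ball 0 1)) :
    ∃ m : ℝ, ∀ x ∈ ball (0 : EuclideanSpace ℝ (Fin n)) 1, u x = m := by
  have hucont := hu.continuousOn
  obtain ⟨R, hR0, hR1, hR⟩ := h.exists_norm_le hκ hρ hρ1 (by simp [hB])
  obtain ⟨x₀, hx₀, hmax⟩ := (isCompact_closedBall (0 : EuclideanSpace ℝ (Fin n)) R).exists_isMaxOn
    ⟨0, mem_closedBall_self hR0⟩ (hucont.mono (closedBall_subset_ball hR1))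
  have hx₀b := closedBall_subset_ball hR1 hx₀
  have hle : ∀ x ∈ ball (0 : EuclideanSpace ℝ (Fin n)) 1, u x ≤ u x₀ := by
    intro x hx
    obtain ⟨y, hy, hyx⟩ := hR x hx
    rw [hB, mul_zero] at hyx
    have : u y = u x := sub_eq_zero.1 (abs_nonpos_iff.1 hyx)
    rw [← this]
    exact hmax hy
  refine ⟨u x₀, ?_⟩
  have hopen1 : IsOpen {x ∈ ball (0 : EuclideanSpace ℝ (Fin n)) 1 | u x = u x₀} := by
    rw [isOpen_iff_mem_nhds]
    rintro x ⟨hx, hux⟩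
    obtain ⟨r, hr, hrs⟩ := Metric.nhds_basis_closedBall.mem_iff.1 (isOpen_ball.mem_nhds hx)
    filter_upwards [ball_mem_nhds x hr] with z hz
    refine ⟨hrs (ball_subset_closedBall hz), ?_⟩
    rw [← hux]
    exact (hu.mono hrs).eq_of_forall_le hr (fun z hz => by rw [hux]; exact hle z (hrs hz)) z hz
  have hopen2 : IsOpen {x ∈ ball (0 : EuclideanSpace ℝ (Fin n)) 1 | u x < u x₀} :=
    hucont.isOpen_inter_preimage isOpen_ball isOpen_Iio
  have hsub := (convex_ball (0 : EuclideanSpace ℝ (Fin n)) 1).isPreconnected.subset_left_of_subset_union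
    hopen1 hopen2 ?_ ?_ ⟨x₀, hx₀b, hx₀b, rfl⟩
  · exact fun x hx => (hsub hx).2
  · rw [Set.disjoint_left]
    rintro x ⟨-, h1⟩ ⟨-, h2⟩
    exact h2.ne h1
  · intro x hx
    rcases (hle x hx).lt_or_eq with h | h
    · exact Or.inr ⟨hx, h⟩
    · exact Or.inl ⟨hx, h⟩

end TransLip

/-! ### Majorants -/

namespace TransLip

variable {B : ℝ → ℝ}

/-- A majorant either vanishes identically or is at least linear near the origin. -/
lemma IsMajorant.eq_zero_or_exists_le (hB : IsMajorant B) :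
    (∀ t, 0 ≤ t → B t = 0) ∨ ∃ b : ℝ, 0 < b ∧ ∀ t, 0 < t → t ≤ 2 → b ≤ B t / t := by
  by_cases h : ∀ t, 0 ≤ t → B t = 0
  · exact Or.inl h
  right
  push Not at h
  obtain ⟨t₀, ht₀, hne⟩ := h
  have hpos : 0 < B t₀ := (hB.nonneg t₀ ht₀).lt_of_ne' hne
  have ht₀' : 0 < t₀ := ht₀.lt_of_ne' (by rintro rfl; exact hne hB.map_zero)
  have h2 : 0 < B 2 / 2 := by
    rcases le_total t₀ 2 with h | h
    · have := hB.monotoneOn (mem_Ici.2 ht₀) (mem_Ici.2 (by norm_num : (0 : ℝ) ≤ 2)) h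
      linarith
    · exact (div_pos hpos ht₀').trans_le
        (hB.antitoneOn_div (mem_Ioi.2 (by norm_num : (0 : ℝ) < 2)) (mem_Ioi.2 ht₀') h)
  exact ⟨B 2 / 2, h2, fun t ht ht2 =>
    hB.antitoneOn_div (mem_Ioi.2 ht) (mem_Ioi.2 (by norm_num : (0 : ℝ) < 2)) ht2⟩

lemma IsRegularMajorant.integrableOn_Ioi (hB : IsRegularMajorant B) {δ : ℝ} (hδ : 0 < δ) :
    IntegrableOn (fun t => B t / t ^ 2) (Ioi δ) := by
  obtain ⟨C, -, δ₀, hδ₀, h⟩ := hB.regular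
  have hm : 0 < min δ (δ₀ / 2) := by positivity
  refine ((h (min δ (δ₀ / 2)) hm ?_).2.1).mono_set (Ioi_subset_Ioi (min_le_left _ _))
  exact (min_le_right _ _).trans_lt (by linarith)

/-- The tail integral increases by at least a multiple of `B(δ)/δ` from `r δ` to `δ`. -/
lemma IsRegularMajorant.le_integral_Ioi_sub (hB : IsRegularMajorant B) {δ r : ℝ} (hδ : 0 < δ)
    (hr : 1 < r) :
    (r - 1) / r ^ 2 * (B δ / δ) ≤
      (∫ t in Ioi δ, B t / t ^ 2) - ∫ t in Ioi (r * δ), B t / t ^ 2 := by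
  have hrδ : δ ≤ r * δ := by nlinarith
  have hI := hB.integrableOn_Ioi hδ
  have hsplit : (∫ t in Ioi δ, B t / t ^ 2) =
      (∫ t in Ioc δ (r * δ), B t / t ^ 2) + ∫ t in Ioi (r * δ), B t / t ^ 2 := by
    rw [← Ioc_union_Ioi_eq_Ioi hrδ]
    exact setIntegral_union (Ioc_disjoint_Ioi le_rfl) measurableSet_Ioi
      (hI.mono_set Ioc_subset_Ioi_self) (hI.mono_set (Ioi_subset_Ioi hrδ))
  have hlow : ∫ _ in Ioc δ (r * δ), B δ / (r * δ) ^ 2 ≤ ∫ t in Ioc δ (r * δ), B t / t ^ 2 := by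
    refine setIntegral_mono_on (integrableOn_const (by simp)) (hI.mono_set Ioc_subset_Ioi_self)
      measurableSet_Ioc fun t ht => ?_
    have ht0 : 0 < t := hδ.trans ht.1
    have h1 := hB.monotoneOn (mem_Ici.2 hδ.le) (mem_Ici.2 ht0.le) ht.1.le
    have h2 := hB.nonneg t ht0.le
    have h3 := ht.2
    gcongr
  rw [setIntegral_const, Real.volume_real_Ioc_of_le hrδ, smul_eq_mul] at hlow
  rw [hsplit, add_sub_cancel_right]
  refine le_trans (le_of_eq ?_) hlow
  field_simp

/-- The tail condition of a regular majorant. -/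
lemma IsRegularMajorant.exists_integral_Ioi_le (hB : IsRegularMajorant B) :
    ∃ C : ℝ, 0 < C ∧ ∃ δ₀ : ℝ, 0 < δ₀ ∧ ∀ δ : ℝ, 0 < δ → δ < δ₀ →
      ∫ t in Ioi δ, B t / t ^ 2 ≤ C * (B δ / δ) := by
  obtain ⟨C, hC, δ₀, hδ₀, h⟩ := hB.regular
  refine ⟨C, hC, δ₀, hδ₀, fun δ h1 h2 => ?_⟩
  have h3 := (h δ h1 h2).2.2
  have h4 : 0 ≤ ∫ t in Ioc 0 δ, B t / t := setIntegral_nonneg measurableSet_Ioc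
    fun t ht => div_nonneg (hB.nonneg t ht.1.le) ht.1.le
  rw [← mul_div_assoc, le_div_iff₀ h1]
  linarith

/-- The Dini condition of a regular majorant, at all scales up to `1`. -/
lemma IsRegularMajorant.exists_integral_Ioc_le (hB : IsRegularMajorant B) {b : ℝ} (hb : 0 < b)
    (hbB : ∀ t, 0 < t → t ≤ 2 → b ≤ B t / t) :
    ∃ C : ℝ, 0 < C ∧ ∀ r : ℝ, 0 < r → r ≤ 1 →
      IntegrableOn (fun t => B t / t) (Ioc 0 r) ∧ ∫ t in Ioc 0 r, B t / t ≤ C * B r := by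
  obtain ⟨C, hC, δ₀, hδ₀, h⟩ := hB.regular
  have hnn : ∀ t, 0 < t → 0 ≤ B t / t := fun t ht => div_nonneg (hB.nonneg t ht.le) ht.le
  set η := min (δ₀ / 2) 1 with hη
  have hη0 : 0 < η := by positivity
  have hηδ : η < δ₀ := (min_le_left _ _).trans_lt (by linarith)
  have hη1 : η ≤ 1 := min_le_right _ _
  have hint : IntegrableOn (fun t => B t / t) (Ioc 0 1) := by
    rw [← Ioc_union_Ioc_eq_Ioc hη0.le hη1]
    refine (h η hη0 hηδ).1.union ?_
    have : ContinuousOn (fun t => B t / t) (Icc η 1) :=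
      (hB.continuousOn.mono fun t ht => hη0.le.trans ht.1).div continuousOn_id
        fun t ht => (hη0.trans_le ht.1).ne'
    exact (this.integrableOn_compact isCompact_Icc).mono_set Ioc_subset_Icc_self
  set J := ∫ t in Ioc 0 1, B t / t with hJ
  have hJ0 : 0 ≤ J := setIntegral_nonneg measurableSet_Ioc fun t ht => hnn t ht.1
  refine ⟨C + J / (b * η), by positivity, fun r hr hr1 => ⟨hint.mono_set (Ioc_subset_Ioc_right hr1),
    ?_⟩⟩
  have hBr := hB.nonneg r hr.le
  rcases le_or_gt r η with hle | hlt
  · have h3 := (h r hr (hle.trans_lt hηδ)).2.2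
    have h4 : 0 ≤ ∫ t in Ioi r, B t / t ^ 2 := setIntegral_nonneg measurableSet_Ioi
      fun t ht => div_nonneg (hB.nonneg t (hr.trans ht).le) (sq_nonneg t)
    have h5 := mul_nonneg hr.le h4
    have h6 : 0 ≤ J / (b * η) * B r := by positivity
    linarith
  · have h3 : ∫ t in Ioc 0 r, B t / t ≤ J := by
      refine setIntegral_mono_set hint ?_ (Ioc_subset_Ioc_right hr1).eventuallyLE
      filter_upwards [self_mem_ae_restrict measurableSet_Ioc] with t ht
      exact hnn t ht.1
    have h4 : b * η ≤ B r := by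
      have := hbB r hr (by linarith)
      rw [le_div_iff₀ hr] at this
      nlinarith
    have h5 : J ≤ J / (b * η) * B r := by
      rw [div_mul_eq_mul_div, le_div_iff₀ (by positivity)]
      gcongr
    have h6 : 0 ≤ C * B r := by positivity
    linarith

end TransLip

/-! ### The gradient estimate -/

lemma InnerProductSpace.HarmonicAt.comp_add_right {E : Type*} [NormedAddCommGroup E]
    [InnerProductSpace ℝ E] [FiniteDimensional ℝ E] {u : E → ℝ} {x k : E}
    (h : InnerProductSpace.HarmonicAt u (x + k)) :
    InnerProductSpace.HarmonicAt (fun z => u (z + k)) x := by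
  have hadd : ContDiff ℝ 2 fun z : E => z + k := by fun_prop
  refine ⟨h.1.comp (g := u) x hadd.contDiffAt, ?_⟩
  have htend : Tendsto (fun z : E => z + k) (𝓝 x) (𝓝 (x + k)) :=
    hadd.continuous.tendsto x
  filter_upwards [htend.eventually h.2] with z hz
  refine Eq.trans ?_ hz
  simp only [InnerProductSpace.laplacian_eq_iteratedFDeriv_stdOrthonormalBasis,
    iteratedFDeriv_comp_add_right]

namespace TransLip

variable {n : ℕ} {B : ℝ → ℝ} {u : EuclideanSpace ℝ (Fin n) → ℝ}

/-- A bounded harmonic function on the ball has gradient `O(1 / (1 - |x|))`. -/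
lemma exists_norm_fderiv_le_div (hu : InnerProductSpace.HarmonicOnNhd u (ball 0 1)) {M : ℝ}
    (hM0 : 0 < M) (hM : ∀ x ∈ ball (0 : EuclideanSpace ℝ (Fin n)) 1, |u x| ≤ M) :
    ∃ C : ℝ, 0 < C ∧ ∀ x ∈ ball (0 : EuclideanSpace ℝ (Fin n)) 1,
      ‖fderiv ℝ u x‖ ≤ C / (1 - ‖x‖) := by
  obtain ⟨G, hG, hgrad⟩ := exists_norm_fderiv_le_of_harmonicOnNhd (EuclideanSpace ℝ (Fin n))
  refine ⟨2 * (G * M), by positivity, fun x hx => ?_⟩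
  have hxn : ‖x‖ < 1 := by simpa using hx
  have hsub : closedBall x ((1 - ‖x‖) / 2) ⊆ ball 0 1 := by
    intro z hz
    rw [mem_closedBall, dist_eq_norm] at hz
    have := norm_le_insert' z x
    rw [mem_ball_zero_iff]; linarith
  have hd : 0 < 1 - ‖x‖ := by linarith
  refine (hgrad u x ((1 - ‖x‖) / 2) M (by linarith) (hu.mono hsub)
    (fun z hz => hM z (hsub hz))).trans_eq ?_
  field_simp

/-- Mean value inequality on a closed ball about the origin inside the unit ball. -/
lemma abs_sub_le_of_norm_fderiv_le (hu : InnerProductSpace.HarmonicOnNhd u (ball 0 1)) {R D : ℝ}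
    (hR : R < 1) (hD : ∀ z ∈ closedBall (0 : EuclideanSpace ℝ (Fin n)) R, ‖fderiv ℝ u z‖ ≤ D)
    {y z : EuclideanSpace ℝ (Fin n)} (hy : ‖y‖ ≤ R) (hz : ‖z‖ ≤ R) :
    |u y - u z| ≤ D * ‖y - z‖ :=
  (convex_closedBall (0 : EuclideanSpace ℝ (Fin n)) R).norm_image_sub_le_of_norm_fderiv_le
    (fun w hw => (hu w (closedBall_subset_ball hR hw)).1.differentiableAt (by norm_num)) hD
    (by simpa using hz) (by simpa using hy)

/-- Comparison of the gradients at a point near the sphere and at a point deeper in the ball. The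
difference `w(x) = u(x + δ V) - u(x)` is harmonic and is `O(B(δ))` on a ball of radius `δ / 2`: the
transversal Lipschitz condition controls it up to replacing the curve by its tangent, which costs
`O(δ²)` times the gradient bound `O(1/δ)`, and `δ = O(B(δ))`. -/
lemma InwardStepBound.exists_norm_fderiv_le {V κ ρ K C₀} (h : InwardStepBound B u V κ ρ K C₀)
    (hκ : 0 < κ) (hρ1 : ρ ≤ 1 / 2) (hK : 0 < K) (hC₀ : 0 < C₀) {b : ℝ} (hb : 0 < b)
    (hbB : ∀ t, 0 < t → t ≤ 2 → b ≤ B t / t)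
    (hu : InnerProductSpace.HarmonicOnNhd u (ball 0 1)) {G : ℝ} (hG : 0 < G)
    (hgrad : ∀ x ∈ ball (0 : EuclideanSpace ℝ (Fin n)) 1, ‖fderiv ℝ u x‖ ≤ G / (1 - ‖x‖)) :
    ∃ C : ℝ, 0 < C ∧ ∀ x ∈ ball (0 : EuclideanSpace ℝ (Fin n)) 1, 3 / 2 * (1 - ‖x‖) ≤ ρ →
      ∃ x' ∈ ball (0 : EuclideanSpace ℝ (Fin n)) 1, (1 + 2 * κ) * (1 - ‖x‖) ≤ 1 - ‖x'‖ ∧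
        ‖fderiv ℝ u x‖ ≤ ‖fderiv ℝ u x'‖ + C * (B (1 - ‖x‖) / (1 - ‖x‖)) := by
  obtain ⟨A, hA, hAgrad⟩ := exists_norm_fderiv_le_of_harmonicOnNhd (EuclideanSpace ℝ (Fin n))
  set C₁ := C₀ + 5 * G * K / b with hC₁
  have hC₁0 : 0 < C₁ := by positivity
  refine ⟨2 * (A * C₁), by positivity, fun x₀ hx₀ hδρ => ?_⟩
  have hx₀n : ‖x₀‖ < 1 := by simpa using hx₀
  set δ := 1 - ‖x₀‖ with hδ
  have hδ0 : 0 < δ := by linarith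
  have hδB : b * δ ≤ B δ := by
    have := hbB δ hδ0 (by linarith [norm_nonneg x₀])
    rwa [le_div_iff₀ hδ0] at this
  have hx₀0 : x₀ ≠ 0 := by
    intro h0
    rw [h0, norm_zero] at hδ
    linarith
  obtain ⟨p, hp, hxp⟩ := exists_mem_sphere_norm_sub_eq hx₀0 hx₀n.le
  rw [← hδ] at hxp
  set k := δ • V p with hk
  have hnear : ∀ x ∈ closedBall x₀ (δ / 2), ‖x‖ ≤ 1 - δ / 2 ∧ ‖x - p‖ ≤ 3 / 2 * δ := by
    intro x hx
    rw [mem_closedBall, dist_eq_norm] at hx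
    have h1 := norm_le_insert' x x₀
    have h2 := norm_sub_le_norm_sub_add_norm_sub x x₀ p
    exact ⟨by linarith, by linarith⟩
  have hmem : ∀ x ∈ closedBall x₀ (δ / 2), x ∈ ball (0 : EuclideanSpace ℝ (Fin n)) 1 := by
    intro x hx
    rw [mem_ball_zero_iff]
    linarith [(hnear x hx).1]
  have hstep := fun x hx => h p hp x (hmem x hx) ((hnear x hx).2.trans hδρ) δ hδ0 (by linarith)
  have hmemk : ∀ x ∈ closedBall x₀ (δ / 2), x + k ∈ ball (0 : EuclideanSpace ℝ (Fin n)) 1 := by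
    intro x hx
    rw [mem_ball_zero_iff]
    have := mul_pos hκ hδ0
    linarith [(hstep x hx).1, (hnear x hx).1]
  have hw : InnerProductSpace.HarmonicOnNhd (fun x => u (x + k) - u x) (closedBall x₀ (δ / 2)) :=
    fun x hx => (hu _ (hmemk x hx)).comp_add_right.sub (hu x (hmem x hx))
  have hwB : ∀ x ∈ closedBall x₀ (δ / 2), |u (x + k) - u x| ≤ C₁ * B δ := by
    intro x hx
    obtain ⟨hxk, y, hy, hyk, huy⟩ := hstep x hx
    have hκδ := mul_pos hκ hδ0
    have hxn := (hnear x hx).1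
    have h1 : |u (x + k) - u y| ≤ G / (δ / 2) * ‖x + k - y‖ := by
      refine abs_sub_le_of_norm_fderiv_le hu (R := 1 - δ / 2) (by linarith) (fun z hz => ?_)
        (by linarith) (by linarith)
      rw [mem_closedBall_zero_iff] at hz
      refine (hgrad z (by rw [mem_ball_zero_iff]; linarith)).trans ?_
      gcongr
      linarith
    have h2 : ‖x + k - y‖ ≤ K * δ * (5 / 2 * δ) := by
      rw [norm_sub_rev]
      refine hyk.trans ?_
      gcongr
      linarith [(hnear x hx).2]
    have h3 : G / (δ / 2) * ‖x + k - y‖ ≤ 5 * G * K / b * B δ := by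
      calc G / (δ / 2) * ‖x + k - y‖ ≤ G / (δ / 2) * (K * δ * (5 / 2 * δ)) := by gcongr
        _ = 5 * G * K / b * (b * δ) := by field_simp
        _ ≤ 5 * G * K / b * B δ := by gcongr
    calc |u (x + k) - u x| ≤ |u (x + k) - u y| + |u y - u x| := abs_sub_le _ _ _
      _ ≤ 5 * G * K / b * B δ + C₀ * B δ := add_le_add (h1.trans h3) huy
      _ = C₁ * B δ := by rw [hC₁]; ring
  have hfd := hAgrad _ x₀ (δ / 2) (C₁ * B δ) (by linarith) hw hwB
  have hx₀c : x₀ ∈ closedBall x₀ (δ / 2) := mem_closedBall_self (by linarith)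
  have hdk : DifferentiableAt ℝ u (x₀ + k) := (hu _ (hmemk x₀ hx₀c)).1.differentiableAt (by norm_num)
  have hd : DifferentiableAt ℝ u x₀ := (hu _ hx₀).1.differentiableAt (by norm_num)
  have heq : fderiv ℝ (fun x => u (x + k) - u x) x₀ = fderiv ℝ u (x₀ + k) - fderiv ℝ u x₀ := by
    have hdk' : DifferentiableAt ℝ (fun x => u (x + k)) x₀ :=
      hdk.comp x₀ (by fun_prop)
    rw [fderiv_fun_sub hdk' hd, fderiv_comp_add_right]
  rw [heq] at hfd
  refine ⟨x₀ + k, hmemk x₀ hx₀c, ?_, ?_⟩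
  · have := (hstep x₀ hx₀c).1
    linarith
  · have h1 := norm_le_insert (fderiv ℝ u (x₀ + k)) (fderiv ℝ u x₀)
    have h2 : A * (C₁ * B δ) / (δ / 2) = 2 * (A * C₁) * (B δ / δ) := by field_simp
    linarith

/-- If the gradient at a point `x` near the sphere exceeds that at some point deeper in the ball by
`O(B(δ)/δ)`, where `δ = 1 - |x|`, then the increments sum to the tail integral of `B(t)/t²`, and
the gradient is `O(B(δ)/δ)`. -/
lemma IsRegularMajorant.exists_norm_fderiv_le (hB : IsRegularMajorant B) {b : ℝ} (hb : 0 < b)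
    (hbB : ∀ t, 0 < t → t ≤ 2 → b ≤ B t / t) {G : ℝ} (hG : 0 < G)
    (hgrad : ∀ x ∈ ball (0 : EuclideanSpace ℝ (Fin n)) 1, ‖fderiv ℝ u x‖ ≤ G / (1 - ‖x‖))
    {κ η C : ℝ} (hκ : 0 < κ) (hη : 0 < η) (hC : 0 < C)
    (hrec : ∀ x ∈ ball (0 : EuclideanSpace ℝ (Fin n)) 1, 1 - ‖x‖ ≤ η →
      ∃ x' ∈ ball (0 : EuclideanSpace ℝ (Fin n)) 1, (1 + 2 * κ) * (1 - ‖x‖) ≤ 1 - ‖x'‖ ∧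
        ‖fderiv ℝ u x‖ ≤ ‖fderiv ℝ u x'‖ + C * (B (1 - ‖x‖) / (1 - ‖x‖))) :
    ∃ C' : ℝ, 0 < C' ∧ ∀ x ∈ ball (0 : EuclideanSpace ℝ (Fin n)) 1,
      ‖fderiv ℝ u x‖ ≤ C' * (B (1 - ‖x‖) / (1 - ‖x‖)) := by
  obtain ⟨T, hT, δ₀, hδ₀, htail⟩ := hB.exists_integral_Ioi_le
  set r := 1 + 2 * κ with hr
  have hr1 : 1 < r := by linarith
  set δ₁ := min η (δ₀ / 2) with hδ₁
  have hδ₁0 : 0 < δ₁ := by positivity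
  set I : ℝ → ℝ := fun δ => ∫ t in Ioi δ, B t / t ^ 2 with hI
  have hInn : ∀ δ, 0 < δ → 0 ≤ I δ := fun δ hδ => setIntegral_nonneg measurableSet_Ioi
    fun t ht => div_nonneg (hB.nonneg t (hδ.trans ht).le) (sq_nonneg t)
  have hIanti : ∀ δ δ', 0 < δ → δ ≤ δ' → I δ' ≤ I δ := by
    intro δ δ' hδ hle
    refine setIntegral_mono_set (hB.integrableOn_Ioi hδ) ?_ (Ioi_subset_Ioi hle).eventuallyLE
    filter_upwards [self_mem_ae_restrict measurableSet_Ioi] with t ht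
    exact div_nonneg (hB.nonneg t (hδ.trans ht).le) (sq_nonneg t)
  -- `Q * I` decreases by at least the allowed increment of the gradient when `δ` becomes `r δ`.
  set Q := C * (r ^ 2 / (r - 1)) with hQ
  have hr10 : 0 < r - 1 := by linarith
  have hQ0 : 0 < Q := by positivity
  have hincr : ∀ δ, 0 < δ → C * (B δ / δ) ≤ Q * I δ - Q * I (r * δ) := by
    intro δ hδ
    have h1 := mul_le_mul_of_nonneg_left (hB.le_integral_Ioi_sub hδ hr1) hQ0.le
    rw [mul_sub] at h1
    refine le_trans (le_of_eq ?_) h1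
    rw [hQ]
    field_simp
  have hiter : ∀ k : ℕ, ∀ x ∈ ball (0 : EuclideanSpace ℝ (Fin n)) 1, δ₁ ≤ r ^ k * (1 - ‖x‖) →
      ‖fderiv ℝ u x‖ ≤ G / δ₁ + Q * I (1 - ‖x‖) := by
    intro k
    induction k with
    | zero =>
      intro x hx hk
      have hxn : 0 < 1 - ‖x‖ := by simpa using hx
      rw [pow_zero, one_mul] at hk
      have h1 : G / (1 - ‖x‖) ≤ G / δ₁ := by gcongr
      have h2 := mul_nonneg hQ0.le (hInn _ hxn)
      linarith [hgrad x hx]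
    | succ k ih =>
      intro x hx hk
      have hxn : 0 < 1 - ‖x‖ := by simpa using hx
      rcases le_or_gt δ₁ (1 - ‖x‖) with hle | hlt
      · have h1 : G / (1 - ‖x‖) ≤ G / δ₁ := by gcongr
        have h2 := mul_nonneg hQ0.le (hInn _ hxn)
        linarith [hgrad x hx]
      · obtain ⟨x', hx', hdist, hle⟩ := hrec x hx (hlt.le.trans (min_le_left _ _))
        have h1 := ih x' hx' (hk.trans (by
          rw [pow_succ, mul_assoc]
          gcongr))
        have h2 := mul_le_mul_of_nonneg_left (hIanti _ _ (by positivity) hdist) hQ0.le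
        linarith [hincr _ hxn]
  refine ⟨G / δ₁ / b + Q * T, by positivity, fun x hx => ?_⟩
  have hxn : 0 < 1 - ‖x‖ := by simpa using hx
  have hBb := hbB _ hxn (by linarith [norm_nonneg x])
  -- The constant `G / δ₁` is absorbed because `B(δ)/δ` is bounded below.
  have h1 : G / δ₁ ≤ G / δ₁ / b * (B (1 - ‖x‖) / (1 - ‖x‖)) := by
    calc G / δ₁ = G / δ₁ / b * b := by field_simp
      _ ≤ _ := by gcongr
  rcases le_or_gt δ₁ (1 - ‖x‖) with hle | hlt
  · have h2 : G / (1 - ‖x‖) ≤ G / δ₁ := by gcongr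
    have h3 : 0 ≤ Q * T * (B (1 - ‖x‖) / (1 - ‖x‖)) := mul_nonneg (by positivity) (hb.le.trans hBb)
    rw [add_mul]
    linarith [hgrad x hx]
  · obtain ⟨k, hk⟩ := pow_unbounded_of_one_lt (δ₁ / (1 - ‖x‖)) hr1
    rw [div_lt_iff₀ hxn] at hk
    have h2 := hiter k x hx hk.le
    have h3 := mul_le_mul_of_nonneg_left (htail _ hxn
      (hlt.trans_le ((min_le_right _ _).trans (by linarith)))) hQ0.le
    rw [add_mul, mul_assoc]
    linarith

/-! ### From the gradient estimate to the Lipschitz estimate -/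

/-- The Hardy–Littlewood argument: move both points inward by half their distance, at a cost
given by the Dini integral, and join the new points by a segment. -/
theorem IsRegularMajorant.mem_lipschitzSpace_of_norm_fderiv_le (hB : IsRegularMajorant B) {b : ℝ}
    (hb : 0 < b) (hbB : ∀ t, 0 < t → t ≤ 2 → b ≤ B t / t)
    (hu : InnerProductSpace.HarmonicOnNhd u (ball 0 1)) {C : ℝ} (hC : 0 < C)
    (hgrad : ∀ x ∈ ball (0 : EuclideanSpace ℝ (Fin n)) 1,
      ‖fderiv ℝ u x‖ ≤ C * (B (1 - ‖x‖) / (1 - ‖x‖))) :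
    u ∈ LipschitzSpace B (ball 0 1) := by
  obtain ⟨J, hJ, hdini⟩ := hB.exists_integral_Ioc_le hb hbB
  have hgrad' : ∀ s : ℝ, 0 < s → ∀ x ∈ ball (0 : EuclideanSpace ℝ (Fin n)) 1, ‖x‖ ≤ 1 - s →
      ‖fderiv ℝ u x‖ ≤ C * (B s / s) := by
    intro s hs x hx hxs
    refine (hgrad x hx).trans ?_
    have hd : s ≤ 1 - ‖x‖ := by linarith
    exact mul_le_mul_of_nonneg_left
      (hB.antitoneOn_div (mem_Ioi.2 hs) (mem_Ioi.2 (hs.trans_le hd)) hd) hC.le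
  have hradial : ∀ r : ℝ, 0 < r → r ≤ 1 → ∀ x ∈ ball (0 : EuclideanSpace ℝ (Fin n)) 1,
      |u ((1 - r) • x) - u x| ≤ C * (J * B r) := by
    intro r hr hr1 x hx
    have hxn : ‖x‖ < 1 := by simpa using hx
    have hnorm : ∀ s ∈ Icc 0 r, ‖(1 - s) • x‖ = (1 - s) * ‖x‖ := by
      intro s hs
      rw [norm_smul, Real.norm_of_nonneg (by linarith [hs.2])]
    have hmem : ∀ s ∈ Icc 0 r, (1 - s) • x ∈ ball (0 : EuclideanSpace ℝ (Fin n)) 1 := by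
      intro s hs
      rw [mem_ball_zero_iff, hnorm s hs]
      nlinarith [norm_nonneg x, hs.1, hs.2]
    have hder : ∀ s ∈ Icc 0 r, HasDerivAt (fun s : ℝ => u ((1 - s) • x))
        (fderiv ℝ u ((1 - s) • x) (-x)) s := by
      intro s hs
      have h1 : HasDerivAt (fun s : ℝ => (1 - s) • x) (-x) s := by
        have := ((hasDerivAt_id s).const_sub 1).smul_const x
        rwa [neg_smul, one_smul] at this
      exact (((hu _ (hmem s hs)).1.differentiableAt (by norm_num)).hasFDerivAt).comp_hasDerivAt s h1
    obtain ⟨hint, hle⟩ := hdini r hr hr1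
    have key := norm_sub_le_integral_of_norm_deriv_le_of_le (f := fun s : ℝ => u ((1 - s) • x))
      (B := fun s => C * (B s / s)) hr.le
      (fun s hs => (hder s hs).continuousAt.continuousWithinAt)
      (fun s hs => (hder s (Ioo_subset_Icc_self hs)).differentiableAt.differentiableWithinAt)
      (ae_of_all _ fun s hs => ?_) ?_
    · simp only [sub_zero, one_smul, Real.norm_eq_abs] at key
      refine key.trans ?_
      rw [intervalIntegral.integral_const_mul, intervalIntegral.integral_of_le hr.le]
      gcongr
    · have hs' := Ioo_subset_Icc_self hs
      rw [(hder s hs').deriv]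
      have h2 : ‖(1 - s) • x‖ ≤ 1 - s := by
        rw [hnorm s hs']
        nlinarith [hs'.2]
      have h3 := hgrad' s hs.1 _ (hmem s hs') h2
      calc ‖fderiv ℝ u ((1 - s) • x) (-x)‖ ≤ ‖fderiv ℝ u ((1 - s) • x)‖ * ‖-x‖ :=
            ContinuousLinearMap.le_opNorm _ _
        _ ≤ ‖fderiv ℝ u ((1 - s) • x)‖ * 1 := by
            gcongr
            rw [norm_neg]; exact hxn.le
        _ ≤ C * (B s / s) := by rwa [mul_one]
    · rw [intervalIntegrable_iff_integrableOn_Ioc_of_le hr.le]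
      exact hint.const_mul C
  refine ⟨2 * (C * J) + 2 * C, by positivity, fun x hx y hy => ?_⟩
  have hxn : ‖x‖ < 1 := by simpa using hx
  have hyn : ‖y‖ < 1 := by simpa using hy
  rcases eq_or_ne x y with rfl | hxy
  · simp [hB.map_zero]
  -- With half the distance, `r < 1` and both points can be shrunk by the factor `1 - r`.
  set r := ‖x - y‖ / 2 with hr
  have hr0 : 0 < r := by
    have := norm_pos_iff.2 (sub_ne_zero.2 hxy)
    positivity
  have hr1 : r < 1 := by linarith [norm_sub_le x y]
  have hshrink : ∀ z : EuclideanSpace ℝ (Fin n), ‖z‖ < 1 → ‖(1 - r) • z‖ ≤ 1 - r := by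
    intro z hz
    rw [norm_smul, Real.norm_of_nonneg (by linarith)]
    nlinarith
  have h1 := hradial r hr0 hr1.le x hx
  have h2 := hradial r hr0 hr1.le y hy
  have h3 : |u ((1 - r) • x) - u ((1 - r) • y)| ≤ 2 * C * B r := by
    have h4 := abs_sub_le_of_norm_fderiv_le hu (R := 1 - r) (D := C * (B r / r)) (by linarith)
      (fun z hz => by
        rw [mem_closedBall_zero_iff] at hz
        exact hgrad' r hr0 z (by rw [mem_ball_zero_iff]; linarith) hz)
      (hshrink x hxn) (hshrink y hyn)
    have h5 : ‖(1 - r) • x - (1 - r) • y‖ ≤ 2 * r := by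
      have h6 : ‖x - y‖ = 2 * r := by rw [hr]; ring
      rw [← smul_sub, norm_smul, Real.norm_of_nonneg (by linarith), h6]
      nlinarith
    have hBr := hB.nonneg r hr0.le
    calc _ ≤ C * (B r / r) * (2 * r) := h4.trans (by gcongr)
      _ = 2 * C * B r := by field_simp
  have h6 : B r ≤ B ‖x - y‖ :=
    hB.monotoneOn (mem_Ici.2 hr0.le) (mem_Ici.2 (norm_nonneg _)) (by linarith)
  have h7 : |u x - u y| ≤ |u x - u ((1 - r) • x)| + |u ((1 - r) • x) - u ((1 - r) • y)| +
      |u ((1 - r) • y) - u y| := by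
    have e1 := abs_sub_le (u x) (u ((1 - r) • x)) (u y)
    have e2 := abs_sub_le (u ((1 - r) • x)) (u ((1 - r) • y)) (u y)
    linarith
  rw [abs_sub_comm (u x) (u ((1 - r) • x))] at h7
  calc |u x - u y| ≤ (2 * (C * J) + 2 * C) * B r := by linarith
    _ ≤ _ := by gcongr

end TransLip

theorem mainTheorem2 {n : ℕ} (B : ℝ → ℝ) (hB : TransLip.IsRegularMajorant B)
    (a : ℝ) (Γ : EuclideanSpace ℝ (Fin n) → ℝ → EuclideanSpace ℝ (Fin n))
    (hΓ : TransLip.IsTransversalFamily a Γ)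
    (u : EuclideanSpace ℝ (Fin n) → ℝ)
    (hu : InnerProductSpace.HarmonicOnNhd u (Metric.ball 0 1))
    (huΓ : TransLip.IsTransversallyLipschitz B Γ u) :
    u ∈ TransLip.LipschitzSpace B (Metric.ball 0 1) := by
  obtain ⟨V, κ, ρ, K, C₀, hκ, hρ, hρ1, hK, hC₀, hstep⟩ :=
    TransLip.exists_inwardStepBound hΓ huΓ
  rcases hB.eq_zero_or_exists_le with hzero | ⟨b, hb, hbB⟩
  · obtain ⟨m, hm⟩ := hstep.eq_of_eq_zero hκ hρ hρ1 (hzero ρ hρ.le) hu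
    refine ⟨1, one_pos, fun x hx y hy => ?_⟩
    rw [hm x hx, hm y hy, hzero _ (norm_nonneg _)]
    simp
  · obtain ⟨M, hM0, hM⟩ := hstep.exists_abs_le hκ hρ hρ1
      (mul_nonneg hC₀.le (hB.nonneg ρ hρ.le)) hu.continuousOn
    obtain ⟨G, hG, hgrad⟩ := TransLip.exists_norm_fderiv_le_div hu hM0 hM
    obtain ⟨C, hC, hrec⟩ := hstep.exists_norm_fderiv_le hκ hρ1 hK hC₀ hb hbB hu hG hgrad
    obtain ⟨C', hC', hfinal⟩ := hB.exists_norm_fderiv_le hb hbB hG hgrad hκ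
      (show 0 < 2 / 3 * ρ by positivity) hC (fun x hx hxρ => hrec x hx (by linarith))
    exact hB.mem_lipschitzSpace_of_norm_fderiv_le hb hbB hu hC' hfinal
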